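/- Let $d\ge 1$ be an integer and $\alpha>-1$. Let $B^d$ be the open Euclidean unit ball of $\mathbb{R}^d$, let $\Pi^d_n$ be the space of polynomials in $d$ variables (with real or complex coefficients) of total degree at most $n$, with $\Pi^d_{-1}=\{0\}$, and for $\beta>-1$ let $$\langle u,v\rangle_\beta=\int_{B^d}u(x)\,\overline{v(x)}\,(1-\|x\|^2)^\beta\,dx .$$ Put $$\langle u,v\rangle_{\alpha,1}=\sum_{i=1}^d\langle \partial_i u,\partial_i v\rangle_\alpha+\frac{1}{\langle 1,1\rangle_\alpha}\,\langle u,1\rangle_\alpha\,\overline{\langle v,1\rangle_\alpha}.$$ For $n\ge 0$ let $$\mathcal V^\beta_n=\{p\in\Pi^d_n:\ \langle p,q\rangle_\beta=0\ \text{ for all } q\in\Pi^d_{n-1}\},\qquad \mathcal V^{\alpha,1}_n=\{p\in\Pi^d_n:\ \langle p,q\rangle_{\alpha,1}=0\ \text{ for all } q\in\Pi^d_{n-1}\},$$ let $\mathcal H^d_n$ be the space of harmonic homogeneous polynomials of degree $n$ in $d$ variables (including $0$), and let $M^\alpha$ be the operator $$M^\alpha(u)(x)=(1-\|x\|^2)^{1-\alpha}\,\Delta\big((1-\|x\|^2)^{1+\alpha}u(x)\big)\qquad(x\in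 B^d),$$ which maps polynomials to polynomials. Then $$\mathcal V^{\alpha,1}_n=\begin{cases}\mathcal V^\alpha_n & \text{if } 0\le n\le 2,\\[2pt] \mathcal H^d_n\oplus_{\alpha,1}M^\alpha(\mathcal V^{\alpha+1}_{n-2}) & \text{if } n\ge 3,\end{cases}$$ where $\oplus_{\alpha,1}$ denotes a direct sum whose two summands are orthogonal with respect to $\langle\cdot,\cdot\rangle_{\alpha,1}$. -/

import Mathlib

open MeasureTheory Laplacian InnerProductSpace

noncomputable section

namespace SobolevBall

variable {𝕜 : Type*} [RCLike 𝕜] {d : ℕ}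

/-- The function `ℝ^d → 𝕜` defined by a `d`-variate polynomial with coefficients in `𝕜`. -/
def polyFun (p : MvPolynomial (Fin d) 𝕜) (x : EuclideanSpace ℝ (Fin d)) : 𝕜 :=
  MvPolynomial.eval (fun i => ((x i : ℝ) : 𝕜)) p

/-- The weight `W_α(x) = (1 - ‖x‖²)^α` (only used in the open unit ball). -/
def weight (α : ℝ) (x : EuclideanSpace ℝ (Fin d)) : ℝ := (1 - ‖x‖ ^ 2) ^ α

/-- The inner product of `L²_α` on the unit ball, for polynomials:
`⟨p, q⟩_α = ∫_{B^d} p(x) conj(q(x)) W_α(x) dx`. -/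
def lebesgueInner (α : ℝ) (p q : MvPolynomial (Fin d) 𝕜) : 𝕜 :=
  ∫ x in Metric.ball (0 : EuclideanSpace ℝ (Fin d)) 1,
    polyFun p x * starRingEnd 𝕜 (polyFun q x) * ((weight α x : ℝ) : 𝕜)

/-- The `(α,1)`-inner product, for polynomials:
`⟨p, q⟩_{α,1} = ⟨∇p, ∇q⟩_α + c_α⁻¹ ⟨p, 1⟩_α conj(⟨q, 1⟩_α)`, where `c_α = ⟨1, 1⟩_α`. -/
def sobolevInner (α : ℝ) (p q : MvPolynomial (Fin d) 𝕜) : 𝕜 :=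
  (∑ i, lebesgueInner α (MvPolynomial.pderiv i p) (MvPolynomial.pderiv i q)) +
    (lebesgueInner α (1 : MvPolynomial (Fin d) 𝕜) 1)⁻¹ *
      (lebesgueInner α p 1 * starRingEnd 𝕜 (lebesgueInner α q 1))

/-- `V` is the `(α,1)`-orthogonal direct sum of its subspaces `A` and `B`. -/
def IsOrthogonalDirectSum (α : ℝ) (V A B : Submodule 𝕜 (MvPolynomial (Fin d) 𝕜)) : Prop :=
  V = A ⊔ B ∧ Disjoint A B ∧ ∀ a ∈ A, ∀ b ∈ B, sobolevInner α a b = 0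

/-! Sanity of the inner products: integrability, and additivity in the first argument. -/

lemma continuous_polyFun (p : MvPolynomial (Fin d) 𝕜) : Continuous (polyFun p) := by
  unfold polyFun
  apply (MvPolynomial.continuous_eval p).comp
  fun_prop

lemma integrableOn_weight {α : ℝ} (hα : -1 < α) :
    IntegrableOn (weight α) (Metric.ball (0 : EuclideanSpace ℝ (Fin d)) 1) := by
  rcases Nat.eq_zero_or_pos d with rfl | hd
  · have : (weight α : EuclideanSpace ℝ (Fin 0) → ℝ) =
        fun _ => weight α (0 : EuclideanSpace ℝ (Fin 0)) := by
      funext x; rw [Subsingleton.elim x 0]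
    rw [this]
    exact integrableOn_const (by exact measure_ball_lt_top.ne)
  · have : Nonempty (Fin d) := ⟨⟨0, hd⟩⟩
    have key : IntegrableOn (fun y : ℝ => y ^ (Module.finrank ℝ (EuclideanSpace ℝ (Fin d)) - 1) •
        (1 - y ^ 2) ^ α) (Set.Ioo 0 1) := by
      have h1 : IntervalIntegrable (fun y : ℝ => (1 - y) ^ α) volume 0 1 := by
        have := (intervalIntegral.intervalIntegrable_rpow' (a := 0) (b := 1) hα).comp_sub_left 1
        simpa using this.symm
      have h2 : IntervalIntegrable (fun y : ℝ => (1 - y) ^ α *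
          (y ^ (Module.finrank ℝ (EuclideanSpace ℝ (Fin d)) - 1) * (1 + y) ^ α)) volume 0 1 := by
        apply h1.mul_continuousOn
        apply ContinuousOn.mul (by fun_prop)
        apply ContinuousOn.rpow_const (by fun_prop)
        intro y hy
        rw [Set.uIcc_of_le zero_le_one] at hy
        left; linarith [hy.1]
      rw [intervalIntegrable_iff_integrableOn_Ioo_of_le zero_le_one] at h2
      refine h2.congr_fun ?_ measurableSet_Ioo
      intro y hy
      have : (1 : ℝ) - y ^ 2 = (1 - y) * (1 + y) := by ring
      simp only [smul_eq_mul]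
      rw [this, Real.mul_rpow (by linarith [hy.2]) (by linarith [hy.1])]
      ring
    exact (integrableOn_fun_norm_addHaar (f := fun y : ℝ => (1 - y ^ 2) ^ α) volume).2 key

lemma integrableOn_inner {α : ℝ} (hα : -1 < α) (p q : MvPolynomial (Fin d) 𝕜) :
    IntegrableOn (fun x => polyFun p x * starRingEnd 𝕜 (polyFun q x) * ((weight α x : ℝ) : 𝕜))
      (Metric.ball (0 : EuclideanSpace ℝ (Fin d)) 1) := by
  have hc : Continuous fun x => polyFun p x * starRingEnd 𝕜 (polyFun q x) :=
    (continuous_polyFun p).mul (RCLike.continuous_conj.comp (continuous_polyFun q))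
  obtain ⟨C, hC⟩ := (isCompact_closedBall (0 : EuclideanSpace ℝ (Fin d)) 1).exists_bound_of_continuousOn
    hc.continuousOn
  refine Integrable.bdd_mul (c := C) (integrableOn_weight hα).ofReal hc.aestronglyMeasurable ?_
  filter_upwards [ae_restrict_mem Metric.isOpen_ball.measurableSet] with x hx
  exact hC x (Metric.ball_subset_closedBall hx)

lemma lebesgueInner_add {α : ℝ} (hα : -1 < α) (p p' q : MvPolynomial (Fin d) 𝕜) :
    lebesgueInner α (p + p') q = lebesgueInner α p q + lebesgueInner α p' q := by
  unfold lebesgueInner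
  rw [← integral_add (integrableOn_inner hα p q) (integrableOn_inner hα p' q)]
  congr 1; funext x
  simp only [polyFun, map_add]; ring

lemma lebesgueInner_smul (α : ℝ) (c : 𝕜) (p q : MvPolynomial (Fin d) 𝕜) :
    lebesgueInner α (c • p) q = c * lebesgueInner α p q := by
  unfold lebesgueInner
  rw [← integral_const_mul]
  congr 1; funext x
  simp only [polyFun, MvPolynomial.smul_eval]; ring

lemma sobolevInner_add {α : ℝ} (hα : -1 < α) (p p' q : MvPolynomial (Fin d) 𝕜) :
    sobolevInner α (p + p') q = sobolevInner α p q + sobolevInner α p' q := by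
  simp only [sobolevInner, map_add, lebesgueInner_add hα, Finset.sum_add_distrib]; ring

lemma sobolevInner_smul (α : ℝ) (c : 𝕜) (p q : MvPolynomial (Fin d) 𝕜) :
    sobolevInner α (c • p) q = c * sobolevInner α p q := by
  simp only [sobolevInner, Derivation.map_smul, lebesgueInner_smul, ← Finset.mul_sum]; ring

variable (𝕜 d)

/-- `V^α_n`: the polynomials of total degree at most `n` that are `⟨·,·⟩_α`-orthogonal to all
polynomials of total degree less than `n`. -/
def lebesgueOP {α : ℝ} (hα : -1 < α) (n : ℕ) : Submodule 𝕜 (MvPolynomial (Fin d) 𝕜) where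
  carrier := {p | p ∈ MvPolynomial.restrictTotalDegree (Fin d) 𝕜 n ∧
    ∀ k < n, ∀ q ∈ MvPolynomial.restrictTotalDegree (Fin d) 𝕜 k, lebesgueInner α p q = 0}
  add_mem' := by
    rintro a b ⟨ha, ha'⟩ ⟨hb, hb'⟩
    refine ⟨add_mem ha hb, fun k hk q hq => ?_⟩
    rw [lebesgueInner_add hα, ha' k hk q hq, hb' k hk q hq, add_zero]
  zero_mem' := ⟨zero_mem _, fun k _ q _ => by simp [lebesgueInner, polyFun]⟩
  smul_mem' := by
    rintro c a ⟨ha, ha'⟩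
    refine ⟨Submodule.smul_mem _ c ha, fun k hk q hq => ?_⟩
    rw [lebesgueInner_smul, ha' k hk q hq, mul_zero]

/-- `V^{α,1}_n`: the polynomials of total degree at most `n` that are `⟨·,·⟩_{α,1}`-orthogonal to
all polynomials of total degree less than `n`. -/
def sobolevOP {α : ℝ} (hα : -1 < α) (n : ℕ) : Submodule 𝕜 (MvPolynomial (Fin d) 𝕜) where
  carrier := {p | p ∈ MvPolynomial.restrictTotalDegree (Fin d) 𝕜 n ∧
    ∀ k < n, ∀ q ∈ MvPolynomial.restrictTotalDegree (Fin d) 𝕜 k, sobolevInner α p q = 0}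
  add_mem' := by
    rintro a b ⟨ha, ha'⟩ ⟨hb, hb'⟩
    refine ⟨add_mem ha hb, fun k hk q hq => ?_⟩
    rw [sobolevInner_add hα, ha' k hk q hq, hb' k hk q hq, add_zero]
  zero_mem' := ⟨zero_mem _, fun k _ q _ => by simp [sobolevInner, lebesgueInner, polyFun]⟩
  smul_mem' := by
    rintro c a ⟨ha, ha'⟩
    refine ⟨Submodule.smul_mem _ c ha, fun k hk q hq => ?_⟩
    rw [sobolevInner_smul, ha' k hk q hq, mul_zero]

/-- `H^d_n`: the homogeneous polynomials of degree `n` with vanishing Laplacian. -/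
def sphericalHarmonics (n : ℕ) : Submodule 𝕜 (MvPolynomial (Fin d) 𝕜) :=
  MvPolynomial.homogeneousSubmodule (Fin d) 𝕜 n ⊓
    LinearMap.ker (∑ i, (MvPolynomial.pderiv i).toLinearMap ∘ₗ (MvPolynomial.pderiv i).toLinearMap :
      MvPolynomial (Fin d) 𝕜 →ₗ[𝕜] MvPolynomial (Fin d) 𝕜)

variable {𝕜 d}

/-- The operator `M^α u = (1 - ‖x‖²)^{1-α} Δ((1 - ‖x‖²)^{1+α} u)` on functions; it is only
evaluated at points of the open unit ball. -/
def opMFun (α : ℝ) (u : EuclideanSpace ℝ (Fin d) → 𝕜) (x : EuclideanSpace ℝ (Fin d)) : 𝕜 :=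
  ((weight (1 - α) x : ℝ) : 𝕜) * (Δ (fun y => ((weight (1 + α) y : ℝ) : 𝕜) * u y)) x

/-! `M^α` maps polynomials to polynomials. -/

lemma contDiff_polyFun (p : MvPolynomial (Fin d) 𝕜) : ContDiff ℝ 2 (polyFun p) := by
  have h (i : Fin d) : ContDiff ℝ 2 fun x : EuclideanSpace ℝ (Fin d) => ((x i : ℝ) : 𝕜) :=
    (RCLike.ofRealCLM (K := 𝕜)).contDiff.comp (by fun_prop)
  induction p using MvPolynomial.induction_on with
  | C a =>
    have : polyFun (MvPolynomial.C a : MvPolynomial (Fin d) 𝕜) = fun _ => a := by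
      funext y; simp [polyFun]
    rw [this]; exact contDiff_const
  | add p q hp hq =>
    have : polyFun (p + q) = fun y => polyFun p y + polyFun q y := by funext y; simp [polyFun]
    rw [this]; exact hp.add hq
  | mul_X p j hp =>
    have : polyFun (p * MvPolynomial.X j) = fun y => polyFun p y * ((y j : ℝ) : 𝕜) := by
      funext y; simp [polyFun]
    rw [this]; exact hp.mul (h j)

lemma hasLineDeriv_polyFun (p : MvPolynomial (Fin d) 𝕜) (x : EuclideanSpace ℝ (Fin d))
    (i : Fin d) :
    fderiv ℝ (polyFun p) x (EuclideanSpace.single i 1) = polyFun (MvPolynomial.pderiv i p) x := by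
  have hdiff (q : MvPolynomial (Fin d) 𝕜) : DifferentiableAt ℝ (polyFun q) x :=
    ((contDiff_polyFun q).differentiable (by norm_num)) x
  induction p using MvPolynomial.induction_on with
  | C a =>
    have : polyFun (MvPolynomial.C a : MvPolynomial (Fin d) 𝕜) = fun _ => a := by
      funext y; simp [polyFun]
    rw [this]; simp [polyFun]
  | add p q hp hq =>
    have : polyFun (p + q) = fun y => polyFun p y + polyFun q y := by funext y; simp [polyFun]
    rw [this, fderiv_fun_add (hdiff p) (hdiff q)]
    simp only [add_apply, hp, hq]
    simp [polyFun]
  | mul_X p j hp =>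
    have : polyFun (p * MvPolynomial.X j) = fun y => polyFun p y * ((y j : ℝ) : 𝕜) := by
      funext y; simp [polyFun]
    have hj : HasFDerivAt (fun y : EuclideanSpace ℝ (Fin d) => ((y j : ℝ) : 𝕜))
        ((RCLike.ofRealCLM (K := 𝕜)).comp (EuclideanSpace.proj j)) x :=
      ((RCLike.ofRealCLM (K := 𝕜)).comp (EuclideanSpace.proj (𝕜 := ℝ) j)).hasFDerivAt
    have h2 := ((hdiff p).hasFDerivAt.mul hj).fderiv
    have h3 : (fun y => polyFun p y * ((y j : ℝ) : 𝕜)) =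
        polyFun p * fun y : EuclideanSpace ℝ (Fin d) => ((y j : ℝ) : 𝕜) := rfl
    rw [this, h3, h2]
    simp only [add_apply, smul_apply, hp]
    by_cases hij : i = j
    · subst hij; simp [polyFun]
    · simp [polyFun, MvPolynomial.pderiv_X_of_ne (Ne.symm hij), mul_comm, Ne.symm hij]

lemma contDiffAt_weight_mul (s : ℝ) (p : MvPolynomial (Fin d) 𝕜)
    {x : EuclideanSpace ℝ (Fin d)} (hx : x ∈ Metric.ball (0 : EuclideanSpace ℝ (Fin d)) 1) :
    ContDiffAt ℝ 2 (fun y => ((weight s y : ℝ) : 𝕜) * polyFun p y) x := by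
  have h0 : (1 : ℝ) - ‖x‖ ^ 2 ≠ 0 := by
    rw [mem_ball_zero_iff] at hx; nlinarith [norm_nonneg x]
  have : ContDiffAt ℝ 2 (weight s) x := by
    unfold weight
    exact ContDiffAt.rpow_const_of_ne (contDiffAt_const.sub (contDiff_norm_sq ℝ).contDiffAt) h0
  exact ((RCLike.ofRealCLM (K := 𝕜)).contDiff.contDiffAt.comp x this).mul
    (contDiff_polyFun p).contDiffAt

lemma fderiv_weight_mul (s : ℝ) (p : MvPolynomial (Fin d) 𝕜) (i : Fin d)
    {x : EuclideanSpace ℝ (Fin d)} (hx : x ∈ Metric.ball (0 : EuclideanSpace ℝ (Fin d)) 1) :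
    fderiv ℝ (fun y => ((weight s y : ℝ) : 𝕜) * polyFun p y) x (EuclideanSpace.single i 1) =
      ((weight s x : ℝ) : 𝕜) * polyFun (MvPolynomial.pderiv i p) x +
      ((weight (s - 1) x : ℝ) : 𝕜) *
        polyFun (MvPolynomial.C (-2 * (s : 𝕜)) * MvPolynomial.X i * p) x := by
  have h0 : (1 : ℝ) - ‖x‖ ^ 2 ≠ 0 := by
    rw [mem_ball_zero_iff] at hx; nlinarith [norm_nonneg x]
  have hw := ((hasStrictFDerivAt_norm_sq x).hasFDerivAt.const_sub 1).rpow_const (p := s) (Or.inl h0)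
  have hw' := (RCLike.ofRealCLM (K := 𝕜)).hasFDerivAt.comp x hw
  have hp : HasFDerivAt (polyFun p) _ x :=
    (((contDiff_polyFun p).differentiable (by norm_num)) x).hasFDerivAt
  have := (hw'.mul hp).fderiv
  have e : (fun y => ((weight s y : ℝ) : 𝕜) * polyFun p y) =
    ((RCLike.ofRealCLM (K := 𝕜)) ∘ fun y => (1 - ‖y‖ ^ 2) ^ s) * polyFun p := by
      funext y; simp [weight]
  rw [e, this]
  simp only [add_apply, smul_apply, hasLineDeriv_polyFun]
  simp [weight, polyFun, EuclideanSpace.inner_single_right, RCLike.real_smul_eq_coe_mul]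
  ring

lemma iteratedFDeriv_weight_mul (s : ℝ) (p : MvPolynomial (Fin d) 𝕜) (i : Fin d)
    {x : EuclideanSpace ℝ (Fin d)} (hx : x ∈ Metric.ball (0 : EuclideanSpace ℝ (Fin d)) 1) :
    iteratedFDeriv ℝ 2 (fun y => ((weight s y : ℝ) : 𝕜) * polyFun p y) x
        ![EuclideanSpace.single i 1, EuclideanSpace.single i 1] =
      ((weight s x : ℝ) : 𝕜) * polyFun (MvPolynomial.pderiv i (MvPolynomial.pderiv i p)) x +
      ((weight (s - 1) x : ℝ) : 𝕜) * (-4 * (s : 𝕜) * (x i : 𝕜) * polyFun (MvPolynomial.pderiv i p) x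
        - 2 * (s : 𝕜) * polyFun p x) +
      ((weight (s - 2) x : ℝ) : 𝕜) * (4 * (s : 𝕜) * ((s : 𝕜) - 1) * (x i : 𝕜) ^ 2 * polyFun p x) := by
  set f : EuclideanSpace ℝ (Fin d) → 𝕜 := fun y => ((weight s y : ℝ) : 𝕜) * polyFun p y with hf
  have hd2 : DifferentiableAt ℝ (fderiv ℝ f) x :=
    ((contDiffAt_weight_mul s p hx).fderiv_right (m := 1) (by norm_num)).differentiableAt
      (by norm_num)
  have h1 : iteratedFDeriv ℝ 2 f x ![EuclideanSpace.single i 1, EuclideanSpace.single i 1] =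
      fderiv ℝ (fun y => fderiv ℝ f y (EuclideanSpace.single i 1)) x
        (EuclideanSpace.single i 1) := by
    rw [iteratedFDeriv_two_apply, fderiv_clm_apply hd2 (by fun_prop)]
    simp
  have h2 : (fun y => fderiv ℝ f y (EuclideanSpace.single i 1)) =ᶠ[nhds x]
      fun y => ((weight s y : ℝ) : 𝕜) * polyFun (MvPolynomial.pderiv i p) y +
      ((weight (s - 1) y : ℝ) : 𝕜) *
        polyFun (MvPolynomial.C (-2 * (s : 𝕜)) * MvPolynomial.X i * p) y := by
    filter_upwards [Metric.isOpen_ball.mem_nhds hx] with y hy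
    exact fderiv_weight_mul s p i hy
  have hD (t : ℝ) (q : MvPolynomial (Fin d) 𝕜) :
      DifferentiableAt ℝ (fun y => ((weight t y : ℝ) : 𝕜) * polyFun q y) x :=
    (contDiffAt_weight_mul t q hx).differentiableAt (by norm_num)
  rw [h1, h2.fderiv_eq, fderiv_fun_add (hD _ _) (hD _ _), add_apply,
    fderiv_weight_mul s _ i hx, fderiv_weight_mul (s - 1) _ i hx, sub_sub, one_add_one_eq_two]
  simp only [polyFun, Derivation.leibniz, MvPolynomial.pderiv_C, MvPolynomial.pderiv_X_self]
  simp
  ring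

/-- For every polynomial `p`, `M^α p` coincides in the open unit ball with a polynomial, which
depends linearly on `p`. -/
theorem exists_opM (α : ℝ) :
    ∃ T : MvPolynomial (Fin d) 𝕜 →ₗ[𝕜] MvPolynomial (Fin d) 𝕜,
      ∀ p, ∀ x ∈ Metric.ball (0 : EuclideanSpace ℝ (Fin d)) 1,
        polyFun (T p) x = opMFun α (polyFun p) x := by
  let D (i : Fin d) : MvPolynomial (Fin d) 𝕜 →ₗ[𝕜] MvPolynomial (Fin d) 𝕜 :=
    (MvPolynomial.pderiv i).toLinearMap
  let mul (q : MvPolynomial (Fin d) 𝕜) : MvPolynomial (Fin d) 𝕜 →ₗ[𝕜] MvPolynomial (Fin d) 𝕜 :=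
    LinearMap.mulLeft 𝕜 q
  let ρ : MvPolynomial (Fin d) 𝕜 := 1 - ∑ i, MvPolynomial.X i ^ 2
  let c (a : 𝕜) : MvPolynomial (Fin d) 𝕜 := MvPolynomial.C a
  refine ⟨∑ i, (mul (ρ ^ 2) ∘ₗ D i ∘ₗ D i + mul (ρ * c (-4 * (1 + (α : 𝕜))) * MvPolynomial.X i) ∘ₗ D i
    - mul (ρ * c (2 * (1 + (α : 𝕜)))) + mul (c (4 * (1 + (α : 𝕜)) * α) * MvPolynomial.X i ^ 2)), ?_⟩
  intro p x hx
  have hx0 : (0 : ℝ) < 1 - ‖x‖ ^ 2 := by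
    rw [mem_ball_zero_iff] at hx; nlinarith [norm_nonneg x]
  have hρ : polyFun ρ x = ((1 - ‖x‖ ^ 2 : ℝ) : 𝕜) := by
    simp [ρ, polyFun, EuclideanSpace.norm_sq_eq]
  have w2 : weight (1 - α) x * weight (1 + α) x = (1 - ‖x‖ ^ 2) ^ 2 := by
    unfold weight
    rw [← Real.rpow_add hx0, show 1 - α + (1 + α) = ((2 : ℕ) : ℝ) by push_cast; ring,
      Real.rpow_natCast]
  have w1 : weight (1 - α) x * weight (1 + α - 1) x = 1 - ‖x‖ ^ 2 := by
    unfold weight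
    rw [← Real.rpow_add hx0]; simp
  have w0 : weight (1 - α) x * weight (1 + α - 2) x = 1 := by
    unfold weight
    rw [← Real.rpow_add hx0]; convert Real.rpow_zero _ using 2; ring
  unfold opMFun
  rw [laplacian_eq_iteratedFDeriv_orthonormalBasis _ (EuclideanSpace.basisFun (Fin d) ℝ)]
  simp only [EuclideanSpace.basisFun_apply, iteratedFDeriv_weight_mul _ _ _ hx, Finset.mul_sum,
    LinearMap.sum_apply]
  have hsum (g : Fin d → MvPolynomial (Fin d) 𝕜) :
      polyFun (∑ i, g i) x = ∑ i, polyFun (g i) x := by simp [polyFun]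
  rw [hsum]
  refine Finset.sum_congr rfl fun i _ => ?_
  have W2 := congrArg (RCLike.ofReal (K := 𝕜)) w2
  have W1 := congrArg (RCLike.ofReal (K := 𝕜)) w1
  have W0 := congrArg (RCLike.ofReal (K := 𝕜)) w0
  push_cast at W2 W1 W0 hρ
  have hL : polyFun ((mul (ρ ^ 2) ∘ₗ D i ∘ₗ D i +
      mul (ρ * c (-4 * (1 + (α : 𝕜))) * MvPolynomial.X i) ∘ₗ D i
      - mul (ρ * c (2 * (1 + (α : 𝕜)))) + mul (c (4 * (1 + (α : 𝕜)) * α) * MvPolynomial.X i ^ 2)) p) x =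
      polyFun ρ x ^ 2 * polyFun (MvPolynomial.pderiv i (MvPolynomial.pderiv i p)) x +
      polyFun ρ x * (-4 * (1 + (α : 𝕜))) * (x i : 𝕜) * polyFun (MvPolynomial.pderiv i p) x -
      polyFun ρ x * (2 * (1 + (α : 𝕜))) * polyFun p x +
      4 * (1 + (α : 𝕜)) * α * (x i : 𝕜) ^ 2 * polyFun p x := by
    simp [mul, D, c, polyFun]
    ring
  rw [hL, hρ]
  push_cast
  linear_combination
    (-polyFun (MvPolynomial.pderiv i (MvPolynomial.pderiv i p)) x) * W2 -
    (-4 * (1 + (α : 𝕜)) * (x i : 𝕜) * polyFun (MvPolynomial.pderiv i p) x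
        - 2 * (1 + (α : 𝕜)) * polyFun p x) * W1 -
    (4 * (1 + (α : 𝕜)) * α * (x i : 𝕜) ^ 2 * polyFun p x) * W0

/-- `M^α` as an operator on polynomials: `opM α p` is the polynomial that coincides with
`(1 - ‖x‖²)^{1-α} Δ((1 - ‖x‖²)^{1+α} p)` in the open unit ball. -/
def opM (α : ℝ) : MvPolynomial (Fin d) 𝕜 →ₗ[𝕜] MvPolynomial (Fin d) 𝕜 :=
  Classical.choose (exists_opM α)

theorem opM_spec (α : ℝ) (p : MvPolynomial (Fin d) 𝕜) {x : EuclideanSpace ℝ (Fin d)}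
    (hx : x ∈ Metric.ball (0 : EuclideanSpace ℝ (Fin d)) 1) :
    polyFun (opM α p) x = opMFun α (polyFun p) x :=
  Classical.choose_spec (exists_opM α) p x hx

end SobolevBall

end

open SobolevBall

/-!
Write `ρ = 1 - ‖x‖²`, `E = x·∇` and `I(f) = ∫_{B^d} f ρ^α`. The only analytic input, besides the
positivity of the weight, is the rule `I(ρ ∂ᵢg) = 2(α+1) I(xᵢ g)` (`setIntegral_polyFun_pderiv`,
`ballInt_rho_mul_pderiv`), which is the divergence theorem for `ρ^(α+1) g`. All further
identities between integrals follow from it by polynomial algebra.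

The centre of the proof is that, with `A q = ρ Δq - 2α E q`, the operators `M^α` and `-Δ A` are
adjoint to each other: `I(∇(M^α u)·∇q) = -I(ρ u Δ(A q))` (`map_gradDot_opMPoly`). For `α ≥ 0` this
is Green's formula used twice. For `α < 0` the boundary terms do not vanish separately, but together
they amount to a vector field tangential to the spheres, which does not contribute (`map_div_eq`).

* The operator `Δ A` lowers degrees by two. Hence `M^α` maps `V^{α+1}_{n-2}` to `V^{α,1}_n`.
* A harmonic homogeneous polynomial is orthogonal to all polynomials of lower degree, for every
  radial weight (`ballInt_harmonic_mul_eq_zero`). Hence `H_n ⊆ V^{α,1}_n`. As `Δ A` kills `H_n`, the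
  two spaces are orthogonal, and so they meet in `0`.
* Let `p ∈ V^{α,1}_n` be orthogonal to `M^α(V^{α+1}_{n-2})`. Then `s = Δ A p` is in `V^{α+1}_{n-2}`,
  and `⟨s, s⟩_{α+1} = -⟨p, M^α s⟩_{α,1} = 0`. So `v = Δp` solves `ρ Δv = (2α+4) E v + (2d+4α) v`.
  Applying `Δ` gives an equation of the same form for `Δv`, with positive constants, and by
  induction on the degree `Δv = 0`; therefore `v` is constant, and orthogonality of `p` to `‖x‖²`
  gives `v = 0` (`lap_eq_zero_of_mem_sobolevOP`). Finally the harmonic polynomial `p` equals its top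
  homogeneous component, because the difference is an element of `V^{α,1}_n` of degree below `n`.

For `n ≤ 2` the two inner products agree against constants, and they are proportional between
polynomials of degree at most two and linear forms (`lebesgueInner_linear`).
-/

open MvPolynomial Filter Topology

/-! ### Integration by parts in the ball -/

section Analysis

variable {𝕜 : Type*} [RCLike 𝕜] {d : ℕ}

/-- A `C¹` truncation of `t ↦ t ^ a` near `t = 0`: it vanishes for `t ≤ ε` and tends to `t ^ a` as
`ε → 0`, for `t > 0`. -/
noncomputable def truncPow (a ε t : ℝ) : ℝ := max (t - ε) 0 ^ 2 * t ^ (a - 2)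

/-- The derivative of `truncPow a ε`. -/
noncomputable def truncPowDeriv (a ε t : ℝ) : ℝ :=
  2 * max (t - ε) 0 * t ^ (a - 2) + max (t - ε) 0 ^ 2 * ((a - 2) * t ^ (a - 2 - 1))

lemma hasDerivAt_max_zero_sq (x : ℝ) :
    HasDerivAt (fun y : ℝ => max y 0 ^ 2) (2 * max x 0) x := by
  rcases lt_trichotomy x 0 with hx | rfl | hx
  · rw [max_eq_right hx.le, mul_zero]
    refine (hasDerivAt_const x (0 : ℝ)).congr_of_eventuallyEq ?_
    filter_upwards [Iio_mem_nhds hx] with y hy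
    rw [max_eq_right (le_of_lt hy)]; ring
  · rw [max_self, mul_zero]
    refine hasDerivAt_iff_isLittleO.2 ?_
    have h : (fun y : ℝ => y ^ 2) =o[𝓝 0] fun y => y := by
      simpa using Asymptotics.isLittleO_pow_pow (𝕜 := ℝ) (m := 1) (n := 2) (by norm_num)
    have h' : (fun y : ℝ => max y 0 ^ 2) =O[𝓝 0] fun y => y ^ 2 := by
      refine Asymptotics.IsBigO.of_bound 1 (Eventually.of_forall fun y => ?_)
      rw [one_mul, Real.norm_of_nonneg (sq_nonneg _), Real.norm_of_nonneg (sq_nonneg _)]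
      rcases le_total y 0 with hy | hy
      · rw [max_eq_right hy, zero_pow two_ne_zero]; exact sq_nonneg y
      · rw [max_eq_left hy]
    simpa using h'.trans_isLittleO h
  · rw [max_eq_left hx.le]
    have h := hasDerivAt_pow 2 x
    simp only [Nat.cast_ofNat, Nat.add_one_sub_one, pow_one] at h
    refine h.congr_of_eventuallyEq ?_
    filter_upwards [Ioi_mem_nhds hx] with y hy
    rw [max_eq_left (le_of_lt hy)]

lemma hasDerivAt_truncPow (a : ℝ) {ε : ℝ} (hε : 0 < ε) (t : ℝ) :
    HasDerivAt (truncPow a ε) (truncPowDeriv a ε t) t := by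
  rcases lt_or_ge t ε with ht | ht
  · have : truncPowDeriv a ε t = 0 := by
      simp [truncPowDeriv, max_eq_right (sub_nonpos.2 ht.le)]
    rw [this]
    refine (hasDerivAt_const t (0 : ℝ)).congr_of_eventuallyEq ?_
    filter_upwards [Iio_mem_nhds ht] with y hy
    simp [truncPow, max_eq_right (sub_nonpos.2 (le_of_lt (Set.mem_Iio.1 hy)))]
  · have h1 := (hasDerivAt_max_zero_sq (t - ε)).comp t ((hasDerivAt_id t).sub_const ε)
    have h2 := Real.hasDerivAt_rpow_const (x := t) (p := a - 2) (Or.inl (hε.trans_le ht).ne')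
    have := h1.mul h2
    rw [Function.comp_apply, mul_one] at this
    exact this

lemma truncPow_of_nonpos (a : ℝ) {ε t : ℝ} (hε : 0 < ε) (ht : t ≤ 0) : truncPow a ε t = 0 := by
  simp [truncPow, max_eq_right (show t - ε ≤ 0 by linarith)]

lemma truncPowDeriv_of_nonpos (a : ℝ) {ε t : ℝ} (hε : 0 < ε) (ht : t ≤ 0) :
    truncPowDeriv a ε t = 0 := by
  simp [truncPowDeriv, max_eq_right (show t - ε ≤ 0 by linarith)]

lemma norm_truncPow_le (a : ℝ) {ε t : ℝ} (hε : 0 < ε) (ht : 0 < t) :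
    ‖truncPow a ε t‖ ≤ t ^ a := by
  have h1 : max (t - ε) 0 ≤ t := max_le (by linarith) ht.le
  have h0 : 0 ≤ max (t - ε) 0 := le_max_right _ _
  have e : t ^ a = t ^ 2 * t ^ (a - 2) := by
    rw [← Real.rpow_natCast t 2, ← Real.rpow_add ht]; congr 1; push_cast; ring
  rw [truncPow, e, Real.norm_of_nonneg (by positivity)]
  gcongr

lemma norm_truncPowDeriv_le (a : ℝ) {ε t : ℝ} (hε : 0 < ε) (ht : 0 < t) :
    ‖truncPowDeriv a ε t‖ ≤ (2 + |a - 2|) * t ^ (a - 1) := by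
  have h1 : max (t - ε) 0 ≤ t := max_le (by linarith) ht.le
  have h0 : 0 ≤ max (t - ε) 0 := le_max_right _ _
  have e1 : t ^ (a - 1) = t * t ^ (a - 2) := by
    nth_rewrite 2 [← Real.rpow_one t]
    rw [← Real.rpow_add ht]; congr 1; ring
  have e2 : t ^ (a - 1) = t ^ 2 * t ^ (a - 2 - 1) := by
    rw [← Real.rpow_natCast t 2, ← Real.rpow_add ht]; congr 1; push_cast; ring
  refine (norm_add_le _ _).trans ?_
  rw [add_mul]
  refine add_le_add ?_ ?_
  · rw [Real.norm_of_nonneg (by positivity), e1, mul_assoc]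
    gcongr
  · rw [norm_mul, norm_mul, Real.norm_of_nonneg (by positivity),
      Real.norm_of_nonneg (Real.rpow_nonneg ht.le _), Real.norm_eq_abs, e2]
    calc max (t - ε) 0 ^ 2 * (|a - 2| * t ^ (a - 2 - 1))
        ≤ t ^ 2 * (|a - 2| * t ^ (a - 2 - 1)) := by gcongr
      _ = _ := by ring

lemma tendsto_truncPow (a : ℝ) {t : ℝ} (ht : 0 < t) :
    Tendsto (fun ε => truncPow a ε t) (𝓝[>] 0) (𝓝 (t ^ a)) := by
  have e : t ^ a = max (t - 0) 0 ^ 2 * t ^ (a - 2) := by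
    rw [sub_zero, max_eq_left ht.le, ← Real.rpow_natCast t 2, ← Real.rpow_add ht]
    congr 1; push_cast; ring
  rw [e]
  have : Continuous fun ε : ℝ => truncPow a ε t := by unfold truncPow; fun_prop
  exact (this.tendsto 0).mono_left nhdsWithin_le_nhds

lemma tendsto_truncPowDeriv (a : ℝ) {t : ℝ} (ht : 0 < t) :
    Tendsto (fun ε => truncPowDeriv a ε t) (𝓝[>] 0) (𝓝 (a * t ^ (a - 1))) := by
  have e1 : t ^ (a - 1) = t * t ^ (a - 2) := by
    nth_rewrite 2 [← Real.rpow_one t]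
    rw [← Real.rpow_add ht]; congr 1; ring
  have e2 : t ^ (a - 1) = t ^ 2 * t ^ (a - 2 - 1) := by
    rw [← Real.rpow_natCast t 2, ← Real.rpow_add ht]; congr 1; push_cast; ring
  have e : a * t ^ (a - 1) = truncPowDeriv a 0 t := by
    rw [truncPowDeriv, sub_zero, max_eq_left ht.le]
    linear_combination 2 * e1 + (a - 2) * e2
  rw [e]
  have : Continuous fun ε : ℝ => truncPowDeriv a ε t := by unfold truncPowDeriv; fun_prop
  exact (this.tendsto 0).mono_left nhdsWithin_le_nhds

lemma one_sub_norm_sq_pos {E : Type*} [SeminormedAddCommGroup E] {x : E}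
    (hx : x ∈ Metric.ball (0 : E) 1) : 0 < 1 - ‖x‖ ^ 2 := by
  rw [mem_ball_zero_iff] at hx; nlinarith [norm_nonneg x]

lemma one_sub_norm_sq_nonpos {E : Type*} [SeminormedAddCommGroup E] {x : E}
    (hx : x ∉ Metric.ball (0 : E) 1) : 1 - ‖x‖ ^ 2 ≤ 0 := by
  rw [mem_ball_zero_iff, not_lt] at hx; nlinarith [norm_nonneg x]

/-- A function that is dominated in the ball by a weight `(1 - ‖x‖²) ^ β` with `β > -1` and vanishes
outside is integrable against any polynomial. -/
lemma integrable_smul_polyFun {β C : ℝ} (hβ : -1 < β) {w : EuclideanSpace ℝ (Fin d) → ℝ}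
    (hw : Measurable w) (hb : ∀ x ∈ Metric.ball (0 : EuclideanSpace ℝ (Fin d)) 1,
      ‖w x‖ ≤ C * weight β x)
    (h0 : ∀ x ∉ Metric.ball (0 : EuclideanSpace ℝ (Fin d)) 1, w x = 0)
    (p : MvPolynomial (Fin d) 𝕜) : Integrable fun x => w x • polyFun p x := by
  obtain ⟨K, hK⟩ := (isCompact_closedBall (0 : EuclideanSpace ℝ (Fin d))
    1).exists_bound_of_continuousOn (continuous_polyFun p).continuousOn
  refine IntegrableOn.integrable_of_forall_notMem_eq_zero
    (s := Metric.ball (0 : EuclideanSpace ℝ (Fin d)) 1) ?_ fun x hx => by simp [h0 x hx]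
  have hwi : IntegrableOn w (Metric.ball (0 : EuclideanSpace ℝ (Fin d)) 1) := by
    refine Integrable.mono' ((integrableOn_weight hβ).const_mul C) hw.aestronglyMeasurable ?_
    filter_upwards [ae_restrict_mem Metric.isOpen_ball.measurableSet] with x hx using hb x hx
  refine Integrable.smul_bdd hwi K (continuous_polyFun p).aestronglyMeasurable ?_
  filter_upwards [ae_restrict_mem Metric.isOpen_ball.measurableSet] with x hx
  exact hK x (Metric.ball_subset_closedBall hx)

/-- Dominated convergence for weights in the ball, tested against a polynomial. -/
lemma tendsto_setIntegral_smul_polyFun {β C : ℝ} (hβ : -1 < β)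
    {w : ℝ → EuclideanSpace ℝ (Fin d) → ℝ} {w₀ : EuclideanSpace ℝ (Fin d) → ℝ}
    (hw : ∀ ε > 0, Measurable (w ε))
    (hb : ∀ ε > 0, ∀ x ∈ Metric.ball (0 : EuclideanSpace ℝ (Fin d)) 1,
      ‖w ε x‖ ≤ C * weight β x)
    (hl : ∀ x ∈ Metric.ball (0 : EuclideanSpace ℝ (Fin d)) 1,
      Tendsto (fun ε => w ε x) (𝓝[>] 0) (𝓝 (w₀ x)))
    (p : MvPolynomial (Fin d) 𝕜) :
    Tendsto (fun ε => ∫ x in Metric.ball (0 : EuclideanSpace ℝ (Fin d)) 1, w ε x • polyFun p x)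
      (𝓝[>] 0)
      (𝓝 (∫ x in Metric.ball (0 : EuclideanSpace ℝ (Fin d)) 1, w₀ x • polyFun p x)) := by
  obtain ⟨K, hK⟩ := (isCompact_closedBall (0 : EuclideanSpace ℝ (Fin d))
    1).exists_bound_of_continuousOn (continuous_polyFun p).continuousOn
  refine tendsto_integral_filter_of_dominated_convergence (fun x => C * weight β x * K) ?_ ?_
    (((integrableOn_weight hβ).const_mul C).mul_const K) ?_
  · filter_upwards [self_mem_nhdsWithin] with ε hε
    exact (hw ε hε).aestronglyMeasurable.smul (continuous_polyFun p).aestronglyMeasurable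
  · filter_upwards [self_mem_nhdsWithin] with ε hε
    filter_upwards [ae_restrict_mem Metric.isOpen_ball.measurableSet] with x hx
    rw [norm_smul]
    exact mul_le_mul (hb ε hε x hx) (hK x (Metric.ball_subset_closedBall hx)) (norm_nonneg _)
      ((norm_nonneg _).trans (hb ε hε x hx))
  · filter_upwards [ae_restrict_mem Metric.isOpen_ball.measurableSet] with x hx
    exact (hl x hx).smul_const _

/-- Integration by parts in the ball for the truncated weights. -/
lemma setIntegral_truncPow_smul_pderiv {α : ℝ} (hα : -1 < α) {ε : ℝ} (hε : 0 < ε) (i : Fin d)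
    (g : MvPolynomial (Fin d) 𝕜) :
    ∫ x in Metric.ball (0 : EuclideanSpace ℝ (Fin d)) 1,
        truncPow (α + 1) ε (1 - ‖x‖ ^ 2) • polyFun (pderiv i g) x =
      ∫ x in Metric.ball (0 : EuclideanSpace ℝ (Fin d)) 1,
        (2 * truncPowDeriv (α + 1) ε (1 - ‖x‖ ^ 2)) • polyFun (X i * g) x := by
  have m1 : Measurable fun x : EuclideanSpace ℝ (Fin d) => truncPow (α + 1) ε (1 - ‖x‖ ^ 2) := by
    unfold truncPow; fun_prop
  have m2 : Measurable fun x : EuclideanSpace ℝ (Fin d) =>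
      2 * truncPowDeriv (α + 1) ε (1 - ‖x‖ ^ 2) := by
    unfold truncPowDeriv; fun_prop
  have z1 : ∀ x ∉ Metric.ball (0 : EuclideanSpace ℝ (Fin d)) 1,
      truncPow (α + 1) ε (1 - ‖x‖ ^ 2) = 0 := fun x hx =>
    truncPow_of_nonpos _ hε (one_sub_norm_sq_nonpos hx)
  have z2 : ∀ x ∉ Metric.ball (0 : EuclideanSpace ℝ (Fin d)) 1,
      2 * truncPowDeriv (α + 1) ε (1 - ‖x‖ ^ 2) = 0 := fun x hx => by
    rw [truncPowDeriv_of_nonpos _ hε (one_sub_norm_sq_nonpos hx), mul_zero]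
  have i1 (p : MvPolynomial (Fin d) 𝕜) := integrable_smul_polyFun (β := α + 1) (C := 1)
    (by linarith) m1
    (fun x hx => by rw [one_mul]; exact norm_truncPow_le _ hε (one_sub_norm_sq_pos hx)) z1 p
  have i2 (p : MvPolynomial (Fin d) 𝕜) := integrable_smul_polyFun (β := α)
    (C := 2 * (2 + |α + 1 - 2|)) hα m2
    (fun x hx => by
      have := norm_truncPowDeriv_le (α + 1) hε (one_sub_norm_sq_pos hx)
      rw [add_sub_cancel_right] at this
      rw [norm_mul, Real.norm_of_nonneg (by norm_num : (0 : ℝ) ≤ 2), mul_assoc]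
      unfold weight
      gcongr) z2 p
  rw [setIntegral_eq_integral_of_forall_compl_eq_zero (fun x hx => by simp [z1 x hx]),
    setIntegral_eq_integral_of_forall_compl_eq_zero (fun x hx => by rw [z2 x hx, zero_smul])]
  have hf (x : EuclideanSpace ℝ (Fin d)) := (hasDerivAt_truncPow (α + 1) hε
    (1 - ‖x‖ ^ 2)).comp_hasFDerivAt x ((hasStrictFDerivAt_norm_sq x).hasFDerivAt.const_sub 1)
  have hg (x : EuclideanSpace ℝ (Fin d)) : HasFDerivAt (polyFun g) _ x :=
    (((contDiff_polyFun g).differentiable (by norm_num)) x).hasFDerivAt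
  have key (x : EuclideanSpace ℝ (Fin d)) :
      (truncPowDeriv (α + 1) ε (1 - ‖x‖ ^ 2) • -(2 • (innerSL ℝ) x))
        (EuclideanSpace.single i 1) • polyFun g x =
      -((2 * truncPowDeriv (α + 1) ε (1 - ‖x‖ ^ 2)) • polyFun (X i * g) x) := by
    simp [polyFun, EuclideanSpace.inner_single_right, RCLike.real_smul_eq_coe_mul]
    ring
  have := integral_bilinear_hasFDerivAt_right_eq_neg_left_of_integrable
    (μ := (volume : Measure (EuclideanSpace ℝ (Fin d))))
    (B := ContinuousLinearMap.lsmul ℝ ℝ (E := 𝕜)) (v := EuclideanSpace.single i (1 : ℝ))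
    (f := fun x => truncPow (α + 1) ε (1 - ‖x‖ ^ 2)) (g := polyFun g)
    (f' := fun x => truncPowDeriv (α + 1) ε (1 - ‖x‖ ^ 2) • -(2 • (innerSL ℝ) x))
    (g' := fderiv ℝ (polyFun g))
    (by simp only [ContinuousLinearMap.lsmul_apply, key]; exact (i2 _).neg)
    (by simp only [ContinuousLinearMap.lsmul_apply, hasLineDeriv_polyFun]; exact i1 _)
    (i1 g) (fun x _ => hf x) (fun x _ => hg x)
  simp only [ContinuousLinearMap.lsmul_apply, hasLineDeriv_polyFun, key, integral_neg,
    neg_neg] at this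
  exact this

/-- Integration by parts in the ball: `∫ ∂ᵢg (1 - ‖x‖²)^(α+1) = 2(α+1) ∫ xᵢ g (1 - ‖x‖²)^α`. There
is no boundary term because `α + 1 > 0`. -/
theorem setIntegral_polyFun_pderiv {α : ℝ} (hα : -1 < α) (i : Fin d)
    (g : MvPolynomial (Fin d) 𝕜) :
    ∫ x in Metric.ball (0 : EuclideanSpace ℝ (Fin d)) 1,
        weight (α + 1) x • polyFun (pderiv i g) x =
      ∫ x in Metric.ball (0 : EuclideanSpace ℝ (Fin d)) 1,
        (2 * (α + 1) * weight α x) • polyFun (X i * g) x := by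
  have t1 := tendsto_setIntegral_smul_polyFun (β := α + 1) (C := 1) (by linarith)
    (w := fun ε x => truncPow (α + 1) ε (1 - ‖x‖ ^ 2)) (w₀ := weight (α + 1))
    (fun ε _ => by unfold truncPow; fun_prop)
    (fun ε hε x hx => by rw [one_mul]; exact norm_truncPow_le _ hε (one_sub_norm_sq_pos hx))
    (fun x hx => tendsto_truncPow _ (one_sub_norm_sq_pos hx)) (pderiv i g)
  have t2 := tendsto_setIntegral_smul_polyFun (β := α) (C := 2 * (2 + |α + 1 - 2|)) hα
    (w := fun ε x => 2 * truncPowDeriv (α + 1) ε (1 - ‖x‖ ^ 2))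
    (w₀ := fun x => 2 * (α + 1) * weight α x)
    (fun ε _ => by unfold truncPowDeriv; fun_prop)
    (fun ε hε x hx => by
      have := norm_truncPowDeriv_le (α + 1) hε (one_sub_norm_sq_pos hx)
      rw [add_sub_cancel_right] at this
      rw [norm_mul, Real.norm_of_nonneg (by norm_num : (0 : ℝ) ≤ 2), mul_assoc]
      unfold weight
      gcongr)
    (fun x hx => by
      have := (tendsto_truncPowDeriv (α + 1) (one_sub_norm_sq_pos hx)).const_mul 2
      rw [add_sub_cancel_right, ← mul_assoc] at this
      exact this) (X i * g)
  refine tendsto_nhds_unique t1 (t2.congr' ?_)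
  filter_upwards [self_mem_nhdsWithin] with ε hε
  exact (setIntegral_truncPow_smul_pderiv hα hε i g).symm

end Analysis

/-! ### Differential operators on polynomials -/

section Algebra

variable {K : Type*} [Field K] {d : ℕ}

/-- The Laplacian `Δ` of a polynomial. -/
noncomputable def lap : MvPolynomial (Fin d) K →ₗ[K] MvPolynomial (Fin d) K :=
  ∑ i, (pderiv i).toLinearMap ∘ₗ (pderiv i).toLinearMap

/-- The Euler operator `x · ∇`. -/
noncomputable def euler : MvPolynomial (Fin d) K →ₗ[K] MvPolynomial (Fin d) K :=
  ∑ i, LinearMap.mulLeft K (X i) ∘ₗ (pderiv i).toLinearMap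

/-- The bilinear product `∇p · ∇q` of the gradients of two polynomials (no complex conjugation). -/
noncomputable def gradDot (p q : MvPolynomial (Fin d) K) : MvPolynomial (Fin d) K :=
  ∑ i, pderiv i p * pderiv i q

/-- The polynomial `‖x‖²`. -/
noncomputable def normSqPoly : MvPolynomial (Fin d) K := ∑ i, X i ^ 2

/-- The polynomial `1 - ‖x‖²`. -/
noncomputable def rho : MvPolynomial (Fin d) K := 1 - normSqPoly

lemma lap_apply (p : MvPolynomial (Fin d) K) : lap p = ∑ i, pderiv i (pderiv i p) := by
  simp [lap]

lemma euler_apply (p : MvPolynomial (Fin d) K) : euler p = ∑ i, X i * pderiv i p := by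
  simp [euler]

lemma pderiv_normSqPoly (i : Fin d) :
    pderiv i (normSqPoly : MvPolynomial (Fin d) K) = 2 * X i := by
  rw [normSqPoly, map_sum, Finset.sum_eq_single i]
  · simp
  · intro j _ hj
    simp [pderiv_X_of_ne hj]
  · simp

lemma pderiv_rho (i : Fin d) : pderiv i (rho : MvPolynomial (Fin d) K) = -2 * X i := by
  rw [rho, map_sub, pderiv_one, pderiv_normSqPoly]; ring

lemma normSqPoly_eq : (normSqPoly : MvPolynomial (Fin d) K) = 1 - rho := by
  rw [rho]; ring

lemma gradDot_comm (p q : MvPolynomial (Fin d) K) : gradDot p q = gradDot q p :=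
  Finset.sum_congr rfl fun _ _ => mul_comm _ _

lemma gradDot_add_left (p p' q : MvPolynomial (Fin d) K) :
    gradDot (p + p') q = gradDot p q + gradDot p' q := by
  simp [gradDot, add_mul, Finset.sum_add_distrib]

lemma gradDot_mul_left (p p' q : MvPolynomial (Fin d) K) :
    gradDot (p * p') q = p * gradDot p' q + p' * gradDot p q := by
  simp only [gradDot, pderiv_mul, Finset.mul_sum, ← Finset.sum_add_distrib]
  exact Finset.sum_congr rfl fun _ _ => by ring

lemma gradDot_C_left (c : K) (q : MvPolynomial (Fin d) K) : gradDot (C c) q = 0 := by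
  simp [gradDot]

lemma gradDot_rho_left (q : MvPolynomial (Fin d) K) : gradDot rho q = -2 * euler q := by
  simp only [gradDot, pderiv_rho, euler_apply, Finset.mul_sum, mul_assoc]

lemma euler_mul (p q : MvPolynomial (Fin d) K) :
    euler (p * q) = p * euler q + q * euler p := by
  simp only [euler_apply, pderiv_mul, Finset.mul_sum, ← Finset.sum_add_distrib]
  exact Finset.sum_congr rfl fun _ _ => by ring

lemma euler_rho : euler (rho : MvPolynomial (Fin d) K) = -2 * normSqPoly := by
  simp only [euler_apply, pderiv_rho, normSqPoly, Finset.mul_sum]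
  exact Finset.sum_congr rfl fun _ _ => by ring

lemma sum_pderiv_mul_pderiv (p q : MvPolynomial (Fin d) K) :
    ∑ i, pderiv i (p * pderiv i q) = gradDot p q + p * lap q := by
  simp only [gradDot, lap_apply, pderiv_mul, Finset.mul_sum, ← Finset.sum_add_distrib]

lemma sum_pderiv_X_mul (f : MvPolynomial (Fin d) K) :
    ∑ i, pderiv i (X i * f) = (d : MvPolynomial (Fin d) K) * f + euler f := by
  simp [euler_apply, Finset.sum_add_distrib, add_comm]

lemma sum_X_mul_mul_pderiv (p q : MvPolynomial (Fin d) K) :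
    ∑ i, X i * (p * pderiv i q) = p * euler q := by
  rw [euler_apply, Finset.mul_sum]
  exact Finset.sum_congr rfl fun _ _ => by ring

lemma pderiv_comm (i j : Fin d) (p : MvPolynomial (Fin d) K) :
    pderiv i (pderiv j p) = pderiv j (pderiv i p) := by
  classical
  ext m
  simp only [coeff_pderiv, Finsupp.add_apply]
  rcases eq_or_ne i j with rfl | h
  · rfl
  · rw [Finsupp.single_eq_of_ne h, Finsupp.single_eq_of_ne h.symm,
      add_right_comm m]
    push_cast; ring

lemma lap_mul (p q : MvPolynomial (Fin d) K) :
    lap (p * q) = p * lap q + q * lap p + 2 * gradDot p q := by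
  simp only [lap_apply, gradDot, pderiv_mul, map_add, Finset.mul_sum, ← Finset.sum_add_distrib]
  exact Finset.sum_congr rfl fun _ _ => by ring

lemma lap_pderiv (i : Fin d) (p : MvPolynomial (Fin d) K) :
    lap (pderiv i p) = pderiv i (lap p) := by
  simp only [lap_apply, map_sum]
  exact Finset.sum_congr rfl fun j _ => by rw [pderiv_comm j i p, pderiv_comm j i]

lemma lap_euler (p : MvPolynomial (Fin d) K) : lap (euler p) = euler (lap p) + 2 * lap p := by
  have h (i : Fin d) : lap (X i * pderiv i p) =
      X i * pderiv i (lap p) + 2 * pderiv i (pderiv i p) := by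
    rw [lap_mul]
    have h1 : lap (X i : MvPolynomial (Fin d) K) = 0 := by
      classical
      rw [lap_apply]
      refine Finset.sum_eq_zero fun j _ => ?_
      rw [pderiv_X, Pi.single_apply]
      split_ifs <;> simp
    have h2 : gradDot (X i) (pderiv i p) = pderiv i (pderiv i p) := by
      rw [gradDot, Finset.sum_eq_single i]
      · simp
      · intro j _ hj
        simp [pderiv_X_of_ne hj.symm]
      · simp
    rw [h1, h2, lap_pderiv]; ring
  rw [euler_apply p, map_sum, Finset.sum_congr rfl fun i _ => h i, Finset.sum_add_distrib,
    ← euler_apply, ← Finset.mul_sum, ← lap_apply]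

lemma lap_rho : lap (rho : MvPolynomial (Fin d) K) = -2 * d := by
  simp only [lap_apply, pderiv_rho, Derivation.leibniz, pderiv_X_self]
  have h : (-2 : MvPolynomial (Fin d) K) = C (-2) := by
    rw [map_neg, map_ofNat]
  simp only [h, pderiv_C]
  simp [mul_comm]

lemma lap_rho_mul (p : MvPolynomial (Fin d) K) :
    lap (rho * p) = rho * lap p - 4 * euler p - 2 * (d : MvPolynomial (Fin d) K) * p := by
  rw [lap_mul, lap_rho, gradDot_rho_left]; ring

/-- The operator `A q = (1 - ‖x‖²) Δq - 2(a-1) x·∇q`. With `a = α + 1` it is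
`(1 - ‖x‖²)^(1-α) div ((1 - ‖x‖²)^α ∇q)`. -/
noncomputable def opA (a : K) (q : MvPolynomial (Fin d) K) : MvPolynomial (Fin d) K :=
  rho * lap q - C (2 * (a - 1)) * euler q

/-- The factor `N u` in the splitting `M u = (1 - ‖x‖²) N u + 4a(a-1) u` of `opMPoly`. -/
noncomputable def opN (a : K) (u : MvPolynomial (Fin d) K) : MvPolynomial (Fin d) K :=
  rho * lap u - C (4 * a) * euler u - C (2 * d * a + 4 * a * (a - 1)) * u

/-- The operator `M u = (1 - ‖x‖²)^(2-a) Δ((1 - ‖x‖²)^a u)`, expanded as a polynomial in terms of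
`u`, `x·∇u` and `Δu`. On the unit sphere `M u = 4a(a-1) u`. -/
noncomputable def opMPoly (a : K) (u : MvPolynomial (Fin d) K) : MvPolynomial (Fin d) K :=
  rho * opN a u + C (4 * a * (a - 1)) * u

/-! ### Linear functionals with the integration-by-parts rule -/

variable {a : K} {I : MvPolynomial (Fin d) K →ₗ[K] K}

lemma map_C_mul (I : MvPolynomial (Fin d) K →ₗ[K] K) (c : K) (f : MvPolynomial (Fin d) K) :
    I (C c * f) = c * I f := by
  rw [C_mul', map_smul, smul_eq_mul]

lemma map_rho_mul_div (hI : ∀ i g, I (rho * pderiv i g) = 2 * a * I (X i * g))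
    (G : Fin d → MvPolynomial (Fin d) K) :
    I (rho * ∑ i, pderiv i (G i)) = 2 * a * I (∑ i, X i * G i) := by
  simp only [Finset.mul_sum, map_sum, hI]

/-- Green's formula for the functional `I`. -/
lemma map_rho_mul_gradDot (hI : ∀ i g, I (rho * pderiv i g) = 2 * a * I (X i * g))
    (p q : MvPolynomial (Fin d) K) :
    I (rho * gradDot p q) = 2 * a * I (p * euler q) - I (rho * (p * lap q)) := by
  have h := map_rho_mul_div hI fun i => p * pderiv i q
  rw [sum_pderiv_mul_pderiv, sum_X_mul_mul_pderiv, mul_add, map_add] at h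
  linear_combination h

/-- The derivative `x_j ∂_i - x_i ∂_j` along a rotation is annihilated by `I`. -/
lemma map_X_mul_pderiv_comm (hI : ∀ i g, I (rho * pderiv i g) = 2 * a * I (X i * g))
    (ha : 2 * a ≠ 0) (i j : Fin d) (f : MvPolynomial (Fin d) K) :
    I (X j * pderiv i f) = I (X i * pderiv j f) := by
  apply mul_left_cancel₀ ha
  rw [← hI, ← hI, pderiv_comm]

/-- The divergence of a vector field `G` and that of its radial part `x (x·G)` have the same
`I`-integral up to `2(a-1) I(x·G)`: what remains of `G` is a combination of rotations. -/
lemma map_div_eq (hI : ∀ i g, I (rho * pderiv i g) = 2 * a * I (X i * g))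
    (ha : 2 * a ≠ 0) (G : Fin d → MvPolynomial (Fin d) K) :
    I (∑ i, pderiv i (G i)) =
      I (∑ j, pderiv j (X j * ∑ i, X i * G i)) + 2 * (a - 1) * I (∑ i, X i * G i) := by
  have h1 : (∑ i, pderiv i (G i)) = rho * (∑ i, pderiv i (G i)) +
      ∑ i, ∑ j, X j * (X j * pderiv i (G i)) := by
    have : ∑ i, ∑ j, X j * (X j * pderiv i (G i)) = normSqPoly * ∑ i, pderiv i (G i) := by
      rw [normSqPoly, Finset.sum_mul_sum, Finset.sum_comm]
      exact Finset.sum_congr rfl fun i _ => Finset.sum_congr rfl fun j _ => by ring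
    rw [this, rho]; ring
  have h2 (i : Fin d) : I (∑ j, X j * (X j * pderiv i (G i))) =
      I (∑ j, X j * pderiv i (X j * G i)) - I (X i * G i) := by
    have : ∑ j, X j * pderiv i (X j * G i) =
        ∑ j, X j * (X j * pderiv i (G i)) + X i * G i := by
      simp only [pderiv_mul, mul_add, Finset.sum_add_distrib]
      rw [add_comm]
      congr 1
      rw [Finset.sum_eq_single i]
      · simp
      · intro j _ hj
        simp [pderiv_X_of_ne hj]
      · simp
    rw [this, map_add]; ring
  have h3 (i : Fin d) : I (∑ j, X j * pderiv i (X j * G i)) =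
      I (∑ j, pderiv j (X j * (X i * G i))) - I (X i * G i) := by
    have e : ∑ j, pderiv j (X j * (X i * G i)) =
        (∑ j, X i * pderiv j (X j * G i)) + X i * G i := by
      have (j : Fin d) : pderiv j (X j * (X i * G i)) =
          X i * pderiv j (X j * G i) + pderiv j (X i) * (X j * G i) := by
        rw [mul_left_comm, pderiv_mul]; ring
      rw [Finset.sum_congr rfl fun j _ => this j, Finset.sum_add_distrib]
      congr 1
      rw [Finset.sum_eq_single i]
      · simp
      · intro j _ hj
        simp [pderiv_X_of_ne hj.symm]
      · simp
    rw [e, map_add, add_sub_cancel_right, map_sum, map_sum]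
    exact Finset.sum_congr rfl fun j _ => map_X_mul_pderiv_comm hI ha i j _
  have h4 : I (∑ j, pderiv j (X j * ∑ i, X i * G i)) =
      ∑ i, I (∑ j, pderiv j (X j * (X i * G i))) := by
    rw [← map_sum, Finset.sum_comm]
    simp only [Finset.mul_sum, map_sum]
  rw [h1, map_add, map_rho_mul_div hI, map_sum I (fun i => ∑ j, X j * (X j * pderiv i (G i))), h4]
  simp only [h2, h3, Finset.sum_sub_distrib]
  rw [map_sum]
  ring

/-- The contribution to `map_gradDot_opMPoly` that Green's formula leaves over, where the values of
`u` and `A q` on the unit sphere enter. -/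
lemma map_euler_mul_opA (hI : ∀ i g, I (rho * pderiv i g) = 2 * a * I (X i * g))
    (ha : 2 * a ≠ 0) (u q : MvPolynomial (Fin d) K) :
    I (euler (u * opA a q)) + (d + 2 * (a - 1)) * I (u * opA a q) =
      -(2 * (a - 1)) * I (gradDot u q) := by
  have e0 : u * opA a q = rho * (u * lap q) - C (2 * (a - 1)) * (u * euler q) := by
    rw [opA]; ring
  have hE (c : K) (f : MvPolynomial (Fin d) K) : euler (C c * f) = C c * euler f := by
    rw [C_mul', map_smul, C_mul']
  have hd (f : MvPolynomial (Fin d) K) : I ((d : MvPolynomial (Fin d) K) * f) = d * I f := by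
    rw [← map_C_mul]; simp
  have t1 := map_rho_mul_div hI fun i => X i * (u * lap q)
  rw [sum_pderiv_X_mul, mul_add, map_add] at t1
  have e1 : ∑ i, X i * (X i * (u * lap q)) = u * lap q - rho * (u * lap q) := by
    rw [rho, normSqPoly, sub_mul, Finset.sum_mul]
    simp only [sq, mul_assoc]
    ring
  rw [e1, map_sub, mul_left_comm, hd] at t1
  have t2 := map_div_eq hI ha fun i => u * pderiv i q
  rw [sum_pderiv_mul_pderiv, sum_X_mul_mul_pderiv, sum_pderiv_X_mul, map_add, map_add, hd] at t2
  have e2 : euler (rho * (u * lap q)) =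
      rho * euler (u * lap q) - (u * lap q + u * lap q) +
        (rho * (u * lap q) + rho * (u * lap q)) := by
    rw [euler_mul, euler_rho, normSqPoly_eq]; ring
  rw [e0, map_sub euler, hE, e2]
  simp only [map_add, map_sub, map_C_mul]
  linear_combination t1 + (2 * (a - 1)) * t2

/-- The central identity: up to sign, `A` followed by the Laplacian is adjoint to `M` between the
Dirichlet form `I(∇p · ∇q)` and the form `I((1 - ‖x‖²) p q)`. -/
theorem map_gradDot_opMPoly (hI : ∀ i g, I (rho * pderiv i g) = 2 * a * I (X i * g))
    (ha : 2 * a ≠ 0) (u q : MvPolynomial (Fin d) K) :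
    I (gradDot (opMPoly a u) q) = -I (rho * (u * lap (opA a q))) := by
  set Q := opA a q with hQ
  have hL : gradDot (opMPoly a u) q = rho * gradDot (opN a u) q - opN a u * euler q -
      opN a u * euler q + C (4 * a * (a - 1)) * gradDot u q := by
    rw [opMPoly, gradDot_add_left, gradDot_mul_left, gradDot_mul_left, gradDot_C_left,
      gradDot_rho_left]
    ring
  have g1 := map_rho_mul_gradDot hI (opN a u) q
  have g2 := map_rho_mul_gradDot hI u Q
  have g3 := map_rho_mul_gradDot hI Q u
  rw [gradDot_comm] at g3
  -- expand `N u · Q` in two ways: by the definition of `Q`, and by that of `N u`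
  have e1 : opN a u * Q = rho * (opN a u * lap q) - C (2 * (a - 1)) * (opN a u * euler q) := by
    rw [hQ, opA]; ring
  have e2 : opN a u * Q = rho * (Q * lap u) - C (4 * a) * (Q * euler u) -
      C (2 * d * a + 4 * a * (a - 1)) * (u * Q) := by
    rw [opN]; ring
  have t := map_euler_mul_opA hI ha u q
  rw [← hQ, euler_mul, map_add] at t
  have f1 := congrArg I e1
  have f2 := congrArg I e2
  simp only [map_sub, map_C_mul] at f1 f2
  rw [hL]
  simp only [map_add, map_sub, map_C_mul]
  linear_combination g1 + g2 - g3 + f1 - f2 + (2 * a) * t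

lemma map_opMPoly (hI : ∀ i g, I (rho * pderiv i g) = 2 * a * I (X i * g))
    (u : MvPolynomial (Fin d) K) : I (opMPoly a u) = -(2 * d) * I (rho * u) := by
  have hd (f : MvPolynomial (Fin d) K) : I ((d : MvPolynomial (Fin d) K) * f) = d * I f := by
    rw [← map_C_mul]; simp
  have h1 := map_rho_mul_gradDot hI rho u
  have t1 := map_rho_mul_div hI fun i => X i * u
  rw [sum_pderiv_X_mul, mul_add, map_add] at t1
  have e1 : ∑ i, X i * (X i * u) = u - rho * u := by
    rw [rho, normSqPoly, sub_mul, Finset.sum_mul]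
    simp only [sq, mul_assoc]
    ring
  rw [e1, map_sub, mul_left_comm, hd] at t1
  have e2 : rho * gradDot rho u = - (rho * euler u) - rho * euler u := by
    rw [gradDot_rho_left]; ring
  have e3 : opMPoly a u = rho * (rho * lap u) - C (4 * a) * (rho * euler u) -
      C (2 * d * a + 4 * a * (a - 1)) * (rho * u) + C (4 * a * (a - 1)) * u := by
    rw [opMPoly, opN]; ring
  rw [e2, map_sub, map_neg] at h1
  rw [e3]
  simp only [map_add I, map_sub, map_C_mul]
  linear_combination h1 + (2 - 2 * a) * t1

/-- For a harmonic polynomial `h`, homogeneous of degree `m`, the form `I(h q)` is determined by the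
Dirichlet form. -/
lemma map_mul_of_harmonic (hI : ∀ i g, I (rho * pderiv i g) = 2 * a * I (X i * g))
    {m : ℕ} {h : MvPolynomial (Fin d) K} (hh : h.IsHomogeneous m) (hl : lap h = 0)
    (q : MvPolynomial (Fin d) K) :
    2 * a * m * I (h * q) = I (rho * gradDot h q) := by
  have hE : euler h = C (m : K) * h := by
    rw [euler_apply, hh.sum_X_mul_pderiv, nsmul_eq_mul]; simp
  rw [gradDot_comm, map_rho_mul_gradDot hI, hl, hE, mul_zero, mul_zero, map_zero, sub_zero,
    mul_left_comm, map_C_mul, mul_comm q]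
  ring

end Algebra

/-! ### Degrees, and the kernel of `Δ ∘ A` -/

section Degree

variable {K : Type*} [Field K] {d : ℕ}

lemma totalDegree_pderiv_le (i : Fin d) (p : MvPolynomial (Fin d) K) :
    (pderiv i p).totalDegree ≤ p.totalDegree - 1 := by
  refine Finset.sup_le fun m hm => ?_
  have h : coeff (m + Finsupp.single i 1) p ≠ 0 := by
    intro h
    rw [mem_support_iff, coeff_pderiv, h, zero_mul] at hm
    exact hm rfl
  have h1 := le_totalDegree (mem_support_iff.2 h)
  rw [Finsupp.sum_add_index' (by simp) (by simp), Finsupp.sum_single_index rfl] at h1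
  exact Nat.le_sub_of_add_le h1

lemma pderiv_eq_zero_of_totalDegree_eq_zero {p : MvPolynomial (Fin d) K}
    (hp : p.totalDegree = 0) (i : Fin d) : pderiv i p = 0 := by
  rw [totalDegree_eq_zero_iff_eq_C.1 hp, pderiv_C]

lemma totalDegree_lap_le (p : MvPolynomial (Fin d) K) :
    (lap p).totalDegree ≤ p.totalDegree - 2 := by
  rw [lap_apply]
  refine totalDegree_finsetSum_le fun i _ => ?_
  have h1 := totalDegree_pderiv_le i p
  have h2 := totalDegree_pderiv_le i (pderiv i p)
  omega

lemma coeff_euler (p : MvPolynomial (Fin d) K) (m : Fin d →₀ ℕ) :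
    coeff m (euler p) = m.degree * coeff m p := by
  classical
  induction p using MvPolynomial.induction_on' with
  | add p q hp hq => simp only [map_add, coeff_add, hp, hq, mul_add]
  | monomial n c =>
    rw [euler_apply, (isHomogeneous_monomial c rfl).sum_X_mul_pderiv, coeff_smul, coeff_monomial,
      nsmul_eq_mul]
    split_ifs with h
    · rw [h]
    · simp

lemma totalDegree_euler_le (p : MvPolynomial (Fin d) K) :
    (euler p).totalDegree ≤ p.totalDegree := by
  refine Finset.sup_le fun m hm => le_totalDegree ?_
  rw [mem_support_iff, coeff_euler] at hm
  exact mem_support_iff.2 (right_ne_zero_of_mul hm)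

lemma totalDegree_normSqPoly_le : (normSqPoly : MvPolynomial (Fin d) K).totalDegree ≤ 2 :=
  totalDegree_finsetSum_le fun _ _ => (totalDegree_X_pow _ _).le

lemma totalDegree_rho_le : (rho : MvPolynomial (Fin d) K).totalDegree ≤ 2 := by
  refine (totalDegree_sub _ _).trans (max_le ?_ totalDegree_normSqPoly_le)
  simp

lemma totalDegree_C_mul_le (c : K) {p : MvPolynomial (Fin d) K} {n : ℕ}
    (hp : p.totalDegree ≤ n) : (C c * p).totalDegree ≤ n := by
  refine (totalDegree_mul _ _).trans ?_
  rw [totalDegree_C, zero_add]; exact hp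

lemma lap_eq_zero_of_totalDegree_lt_two {p : MvPolynomial (Fin d) K}
    (h : p.totalDegree < 2) : lap p = 0 := by
  rw [lap_apply]
  refine Finset.sum_eq_zero fun i _ => pderiv_eq_zero_of_totalDegree_eq_zero ?_ i
  have := totalDegree_pderiv_le i p
  omega

lemma totalDegree_rho_mul_lap_le (p : MvPolynomial (Fin d) K) :
    (rho * lap p).totalDegree ≤ p.totalDegree := by
  by_cases h : p.totalDegree < 2
  · simp [lap_eq_zero_of_totalDegree_lt_two h]
  · have := totalDegree_mul rho (lap p)
    have := totalDegree_lap_le p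
    have := totalDegree_rho_le (K := K) (d := d)
    omega

lemma totalDegree_opMPoly_le (a : K) {u : MvPolynomial (Fin d) K} {n : ℕ}
    (hu : u.totalDegree ≤ n) : (opMPoly a u).totalDegree ≤ n + 2 := by
  have hN : (opN a u).totalDegree ≤ n := by
    refine (totalDegree_sub _ _).trans (max_le ((totalDegree_sub _ _).trans (max_le ?_ ?_)) ?_)
    · exact (totalDegree_rho_mul_lap_le u).trans hu
    · exact totalDegree_C_mul_le _ ((totalDegree_euler_le u).trans hu)
    · exact totalDegree_C_mul_le _ hu
  refine (totalDegree_add _ _).trans (max_le ?_ ((totalDegree_C_mul_le _ hu).trans (by omega)))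
  have := totalDegree_mul rho (opN a u)
  have := totalDegree_rho_le (K := K) (d := d)
  omega

lemma lap_opA (a : K) (q : MvPolynomial (Fin d) K) :
    lap (opA a q) = rho * lap (lap q) - C (2 * a + 2) * euler (lap q) -
      C (2 * d + 4 * (a - 1)) * lap q := by
  have h4 : (4 : MvPolynomial (Fin d) K) = C 4 := (map_ofNat C 4).symm
  have h2 : (2 : MvPolynomial (Fin d) K) = C 2 := (map_ofNat C 2).symm
  have hd : (d : MvPolynomial (Fin d) K) = C (d : K) := by simp
  rw [opA, map_sub, C_mul', map_smul, lap_euler, lap_rho_mul, ← C_mul', h4, h2, hd]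
  simp only [map_add, map_sub, map_mul, map_one, ← h4, ← h2]
  ring

lemma totalDegree_lap_opA_le (a : K) {q : MvPolynomial (Fin d) K} {n : ℕ}
    (hq : q.totalDegree ≤ n + 2) : (lap (opA a q)).totalDegree ≤ n := by
  have hl : (lap q).totalDegree ≤ n := (totalDegree_lap_le q).trans (by omega)
  rw [lap_opA]
  refine (totalDegree_sub _ _).trans (max_le ((totalDegree_sub _ _).trans (max_le ?_ ?_)) ?_)
  · exact (totalDegree_rho_mul_lap_le _).trans hl
  · exact totalDegree_C_mul_le _ ((totalDegree_euler_le _).trans hl)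
  · exact totalDegree_C_mul_le _ hl

lemma coeff_lap (p : MvPolynomial (Fin d) K) (m : Fin d →₀ ℕ) :
    coeff m (lap p) = ∑ i, coeff (m + Finsupp.single i 1 + Finsupp.single i 1) p *
      (m i + 1 + 1) * (m i + 1) := by
  simp [lap_apply, coeff_sum, coeff_pderiv]

lemma lap_homogeneousComponent (n : ℕ) {p : MvPolynomial (Fin d) K} (hp : lap p = 0) :
    lap (homogeneousComponent n p) = 0 := by
  classical
  ext m
  have h := congrArg (coeff m) hp
  rw [coeff_lap, coeff_zero] at h
  rw [coeff_lap, coeff_zero]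
  simp only [coeff_homogeneousComponent, map_add, Finsupp.degree_single]
  split_ifs
  · exact h
  · simp

end Degree

section Kernel

variable {𝕜 : Type*} [RCLike 𝕜] {d : ℕ}

/-- A coefficientwise consequence of Euler's identity: `a E v + b v` vanishes only if every
monomial `x^m` of `v` satisfies `a |m| + b = 0`. -/
lemma coeff_eq_zero_of_euler {a b : ℝ} {v : MvPolynomial (Fin d) 𝕜}
    (h : C (a : 𝕜) * euler v + C (b : 𝕜) * v = 0) {m : Fin d →₀ ℕ}
    (hm : a * m.degree + b ≠ 0) : coeff m v = 0 := by
  have h1 := congrArg (coeff m) h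
  rw [coeff_add, coeff_C_mul, coeff_C_mul, coeff_euler, coeff_zero, ← mul_assoc, ← add_mul] at h1
  refine (mul_eq_zero.1 h1).resolve_left fun h2 => hm ?_
  exact_mod_cast h2

/-- If `v` solves `(1 - ‖x‖²) Δv = a E v + b v`, then so does `Δv`, with other constants. -/
lemma rho_mul_lap_lap {a b : ℝ} {v : MvPolynomial (Fin d) 𝕜}
    (h : rho * lap v = C (a : 𝕜) * euler v + C (b : 𝕜) * v) :
    rho * lap (lap v) = C ((a + 4 : ℝ) : 𝕜) * euler (lap v) +
      C ((b + 2 * d + 2 * a : ℝ) : 𝕜) * lap v := by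
  have h4 : (4 : MvPolynomial (Fin d) 𝕜) = C 4 := (map_ofNat C 4).symm
  have h2 : (2 : MvPolynomial (Fin d) 𝕜) = C 2 := (map_ofNat C 2).symm
  have hd : (d : MvPolynomial (Fin d) 𝕜) = C (d : 𝕜) := by simp
  have h1 := congrArg lap h
  rw [lap_rho_mul, map_add, C_mul', C_mul', map_smul, map_smul, lap_euler, ← C_mul', ← C_mul',
    h4, h2, hd] at h1
  push_cast
  simp only [map_add, map_mul]
  linear_combination h1

lemma eq_zero_of_rho_mul_lap {a b : ℝ} (ha : 0 < a) (hb : 0 < b) {v : MvPolynomial (Fin d) 𝕜}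
    (h : rho * lap v = C (a : 𝕜) * euler v + C (b : 𝕜) * v) : v = 0 := by
  obtain ⟨N, hN⟩ : ∃ N, v.totalDegree < N := ⟨_, Nat.lt_succ_self _⟩
  induction N generalizing a b v with
  | zero => omega
  | succ N ih =>
    have hw : lap v = 0 := by
      rcases Nat.eq_zero_or_pos v.totalDegree with h0 | h0
      · rw [lap_apply]
        simp [pderiv_eq_zero_of_totalDegree_eq_zero h0]
      · refine ih (by positivity) (by positivity) (rho_mul_lap_lap h) ?_
        have := totalDegree_lap_le v
        omega
    rw [hw, mul_zero] at h
    ext m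
    exact coeff_eq_zero_of_euler h.symm (by positivity)

/-- The polynomials killed by `Δ ∘ A` are those with constant Laplacian. -/
lemma lap_eq_C_of_lap_opA_eq_zero (hd : 1 ≤ d) {α : ℝ} (hα : -1 < α)
    {p : MvPolynomial (Fin d) 𝕜} (h : lap (opA ((α : 𝕜) + 1) p) = 0) :
    lap p = C (coeff 0 (lap p)) := by
  have hd' : (1 : ℝ) ≤ d := by exact_mod_cast hd
  set v := lap p with hv
  have h1 : rho * lap v = C ((2 * α + 4 : ℝ) : 𝕜) * euler v +
      C ((2 * d + 4 * α : ℝ) : 𝕜) * v := by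
    rw [lap_opA, ← hv, sub_sub, sub_eq_zero] at h
    rw [h]
    push_cast
    ring_nf
  have hw : lap v = 0 :=
    eq_zero_of_rho_mul_lap (by linarith) (by nlinarith) (rho_mul_lap_lap h1)
  rw [hw, mul_zero] at h1
  ext m
  rw [coeff_C]
  split_ifs with hm
  · rw [hm]
  · refine coeff_eq_zero_of_euler h1.symm ?_
    have : (1 : ℝ) ≤ m.degree := by
      have : m.degree ≠ 0 := fun h => hm ((Finsupp.degree_eq_zero_iff m).1 h).symm
      exact_mod_cast Nat.one_le_iff_ne_zero.2 this
    nlinarith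

lemma eq_C_of_pderiv_eq_zero {p : MvPolynomial (Fin d) 𝕜}
    (h : ∀ i, pderiv i p = 0) : p = C (coeff 0 p) := by
  ext m
  rw [coeff_C]
  split_ifs with hm
  · rw [hm]
  · have h1 : C ((1 : ℝ) : 𝕜) * euler p + C ((0 : ℝ) : 𝕜) * p = 0 := by
      simp [euler_apply, h]
    refine coeff_eq_zero_of_euler h1 ?_
    have : m.degree ≠ 0 := fun h => hm ((Finsupp.degree_eq_zero_iff m).1 h).symm
    simpa using this

/-- A polynomial is determined by its values in the unit ball of `ℝ^d`. -/
lemma eq_of_polyFun_eq {p q : MvPolynomial (Fin d) 𝕜}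
    (h : ∀ x ∈ Metric.ball (0 : EuclideanSpace ℝ (Fin d)) 1, polyFun p x = polyFun q x) :
    p = q := by
  -- the ball contains a cube `(-δ, δ)^d`, and polynomials are determined on infinite boxes
  have ho : IsOpen ((WithLp.ofLp : EuclideanSpace ℝ (Fin d) → Fin d → ℝ) ''
      Metric.ball (0 : EuclideanSpace ℝ (Fin d)) 1) :=
    (PiLp.homeomorph 2 fun _ : Fin d => ℝ).isOpenMap _ Metric.isOpen_ball
  obtain ⟨δ, hδ, hb⟩ := Metric.isOpen_iff.1 ho 0 ⟨0, by simp, rfl⟩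
  refine funext_set (fun _ => (fun t : ℝ => (t : 𝕜)) '' Set.Ioo (-δ) δ)
    (fun _ => (Set.Ioo_infinite (by linarith)).image RCLike.ofReal_injective.injOn) ?_
  intro y hy
  choose t ht hty using fun i => hy i trivial
  obtain ⟨x, hx, hxt⟩ := hb (show t ∈ Metric.ball 0 δ by
    rw [mem_ball_zero_iff, pi_norm_lt_iff hδ]
    exact fun i => abs_lt.2 (ht i))
  have := h x hx
  have hyx : (fun i => ((x i : ℝ) : 𝕜)) = y := by
    funext i
    rw [← hty i, ← hxt]
  rwa [polyFun, polyFun, hyx] at this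

end Kernel

/-! ### The two inner products, and the operator `M^α` -/

section InnerProducts

variable {𝕜 : Type*} [RCLike 𝕜] {d : ℕ}

/-- The linear functional `f ↦ ∫_{B^d} f(x) (1 - ‖x‖²)^α dx` on polynomials. -/
noncomputable def ballInt {α : ℝ} (hα : -1 < α) : MvPolynomial (Fin d) 𝕜 →ₗ[𝕜] 𝕜 where
  toFun f := lebesgueInner α f 1
  map_add' p q := lebesgueInner_add hα p q 1
  map_smul' c p := lebesgueInner_smul α c p 1

/-- The polynomial with complex conjugate coefficients. -/
noncomputable abbrev conjPoly : MvPolynomial (Fin d) 𝕜 →+* MvPolynomial (Fin d) 𝕜 :=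
  MvPolynomial.map (starRingEnd 𝕜)

lemma polyFun_add (p q : MvPolynomial (Fin d) 𝕜) (x : EuclideanSpace ℝ (Fin d)) :
    polyFun (p + q) x = polyFun p x + polyFun q x := by simp [polyFun]

lemma polyFun_sub (p q : MvPolynomial (Fin d) 𝕜) (x : EuclideanSpace ℝ (Fin d)) :
    polyFun (p - q) x = polyFun p x - polyFun q x := by simp [polyFun]

lemma polyFun_mul (p q : MvPolynomial (Fin d) 𝕜) (x : EuclideanSpace ℝ (Fin d)) :
    polyFun (p * q) x = polyFun p x * polyFun q x := by simp [polyFun]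

lemma polyFun_C (c : 𝕜) (x : EuclideanSpace ℝ (Fin d)) : polyFun (C c) x = c := by
  simp [polyFun]

lemma polyFun_sum (f : Fin d → MvPolynomial (Fin d) 𝕜) (x : EuclideanSpace ℝ (Fin d)) :
    polyFun (∑ i, f i) x = ∑ i, polyFun (f i) x := by simp [polyFun]

lemma polyFun_rho (x : EuclideanSpace ℝ (Fin d)) :
    polyFun (rho : MvPolynomial (Fin d) 𝕜) x = ((1 - ‖x‖ ^ 2 : ℝ) : 𝕜) := by
  simp [rho, normSqPoly, polyFun, EuclideanSpace.norm_sq_eq]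

lemma polyFun_conjPoly (p : MvPolynomial (Fin d) 𝕜) (x : EuclideanSpace ℝ (Fin d)) :
    polyFun (conjPoly p) x = starRingEnd 𝕜 (polyFun p x) := by
  have h := eval₂_comp_left (starRingEnd 𝕜) (RingHom.id 𝕜) (fun i => ((x i : ℝ) : 𝕜)) p
  rw [polyFun, polyFun, eval_map, ← eval₂_id, h]
  simp [Function.comp_def]

lemma conjPoly_conjPoly (p : MvPolynomial (Fin d) 𝕜) : conjPoly (conjPoly p) = p := by
  have h : (starRingEnd 𝕜).comp (starRingEnd 𝕜) = RingHom.id 𝕜 :=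
    RingHom.ext fun z => RCLike.conj_conj z
  rw [conjPoly, MvPolynomial.map_map, h, MvPolynomial.map_id]

lemma totalDegree_conjPoly_le (p : MvPolynomial (Fin d) 𝕜) :
    (conjPoly p).totalDegree ≤ p.totalDegree := Finset.sup_mono (support_map_subset _ _)

lemma lebesgueInner_eq_ballInt {α : ℝ} (hα : -1 < α) (p q : MvPolynomial (Fin d) 𝕜) :
    lebesgueInner α p q = ballInt hα (p * conjPoly q) := by
  change _ = lebesgueInner α (p * conjPoly q) 1
  unfold lebesgueInner
  congr 1; funext x
  rw [polyFun_mul, polyFun_conjPoly, show polyFun (1 : MvPolynomial (Fin d) 𝕜) x = 1 by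
    simp [polyFun], map_one, mul_one]

lemma weight_add_one (α : ℝ) {x : EuclideanSpace ℝ (Fin d)}
    (hx : x ∈ Metric.ball (0 : EuclideanSpace ℝ (Fin d)) 1) :
    weight (α + 1) x = (1 - ‖x‖ ^ 2) * weight α x := by
  rw [weight, weight, Real.rpow_add_one (one_sub_norm_sq_pos hx).ne', mul_comm]

lemma ballInt_add_one {α : ℝ} (hα : -1 < α) (hα' : -1 < α + 1) (f : MvPolynomial (Fin d) 𝕜) :
    ballInt hα' f = ballInt hα (rho * f) := by
  change lebesgueInner _ _ _ = lebesgueInner _ _ _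
  unfold lebesgueInner
  refine setIntegral_congr_fun Metric.isOpen_ball.measurableSet fun x hx => ?_
  simp only [weight_add_one α hx, polyFun_mul, polyFun_rho, map_mul]
  ring

lemma ballInt_rho_mul_pderiv {α : ℝ} (hα : -1 < α) (i : Fin d) (g : MvPolynomial (Fin d) 𝕜) :
    ballInt hα (rho * pderiv i g) = 2 * ((α : 𝕜) + 1) * ballInt hα (X i * g) := by
  have h := setIntegral_polyFun_pderiv hα i g
  rw [← ballInt_add_one hα (by linarith)]
  change lebesgueInner _ _ _ = _ * lebesgueInner _ _ _
  unfold lebesgueInner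
  rw [← integral_const_mul]
  have h1 (x : EuclideanSpace ℝ (Fin d)) : polyFun (1 : MvPolynomial (Fin d) 𝕜) x = 1 := by
    simp [polyFun]
  simp only [h1, map_one, mul_one]
  simp only [RCLike.real_smul_eq_coe_mul] at h
  push_cast at h
  refine Eq.trans ?_ (h.trans ?_) <;> (congr 1; funext x; ring)

lemma conj_ballInt {α : ℝ} (hα : -1 < α) (f : MvPolynomial (Fin d) 𝕜) :
    starRingEnd 𝕜 (ballInt hα f) = ballInt hα (conjPoly f) := by
  change starRingEnd 𝕜 (lebesgueInner _ _ _) = lebesgueInner _ _ _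
  unfold lebesgueInner
  rw [← integral_conj]
  congr 1; funext x
  have h1 : polyFun (1 : MvPolynomial (Fin d) 𝕜) x = 1 := by simp [polyFun]
  simp only [polyFun_conjPoly, h1, map_mul, map_one, RCLike.conj_ofReal]

lemma lebesgueInner_conj_symm {α : ℝ} (hα : -1 < α) (p q : MvPolynomial (Fin d) 𝕜) :
    starRingEnd 𝕜 (lebesgueInner α q p) = lebesgueInner α p q := by
  rw [lebesgueInner_eq_ballInt hα, lebesgueInner_eq_ballInt hα, conj_ballInt, map_mul,
    conjPoly_conjPoly, mul_comm]

lemma lebesgueInner_self {α : ℝ} (p : MvPolynomial (Fin d) 𝕜) :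
    lebesgueInner α p p = ((∫ x in Metric.ball (0 : EuclideanSpace ℝ (Fin d)) 1,
      ‖polyFun p x‖ ^ 2 * weight α x : ℝ) : 𝕜) := by
  rw [← integral_ofReal, lebesgueInner]
  congr 1; funext x
  rw [RCLike.mul_conj]; push_cast; rfl

lemma setIntegral_norm_sq_nonneg {α : ℝ} (p : MvPolynomial (Fin d) 𝕜) :
    0 ≤ ∫ x in Metric.ball (0 : EuclideanSpace ℝ (Fin d)) 1, ‖polyFun p x‖ ^ 2 * weight α x :=
  setIntegral_nonneg Metric.isOpen_ball.measurableSet fun _ hx =>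
    mul_nonneg (sq_nonneg _) (Real.rpow_nonneg (one_sub_norm_sq_pos hx).le _)

lemma re_lebesgueInner_self_nonneg {α : ℝ} (p : MvPolynomial (Fin d) 𝕜) :
    0 ≤ RCLike.re (lebesgueInner α p p) := by
  rw [lebesgueInner_self, RCLike.ofReal_re]
  exact setIntegral_norm_sq_nonneg p

lemma ofReal_re_lebesgueInner_self {α : ℝ} (p : MvPolynomial (Fin d) 𝕜) :
    ((RCLike.re (lebesgueInner α p p) : ℝ) : 𝕜) = lebesgueInner α p p := by
  rw [lebesgueInner_self, RCLike.ofReal_re]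

lemma eq_zero_of_lebesgueInner_self {α : ℝ} (hα : -1 < α) {p : MvPolynomial (Fin d) 𝕜}
    (h : lebesgueInner α p p = 0) : p = 0 := by
  rw [lebesgueInner_self, RCLike.ofReal_eq_zero] at h
  have hi : IntegrableOn (fun x => ‖polyFun p x‖ ^ 2 * weight α x)
      (Metric.ball (0 : EuclideanSpace ℝ (Fin d)) 1) := by
    have := (integrableOn_inner hα p p).re
    refine Integrable.congr this (Eventually.of_forall fun x => ?_)
    simp only [RCLike.mul_conj]
    rw [← RCLike.ofReal_pow, ← RCLike.ofReal_mul, RCLike.ofReal_re]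
  rw [setIntegral_eq_zero_iff_of_nonneg_ae ?_ hi] at h
  · have h2 : polyFun p =ᵐ[volume.restrict (Metric.ball (0 : EuclideanSpace ℝ (Fin d)) 1)]
        fun _ => 0 := by
      filter_upwards [h, ae_restrict_mem Metric.isOpen_ball.measurableSet] with x hx hxb
      have hw : weight α x ≠ 0 := (Real.rpow_pos_of_pos (one_sub_norm_sq_pos hxb) _).ne'
      simpa [hw] using hx
    have h3 := Measure.eqOn_open_of_ae_eq h2 Metric.isOpen_ball
      (continuous_polyFun p).continuousOn continuousOn_const
    refine eq_of_polyFun_eq fun x hx => ?_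
    rw [h3 hx]; simp [polyFun]
  · filter_upwards [ae_restrict_mem Metric.isOpen_ball.measurableSet] with x hx
    exact mul_nonneg (sq_nonneg _) (Real.rpow_nonneg (one_sub_norm_sq_pos hx).le _)

lemma ballInt_one_ne_zero {α : ℝ} (hα : -1 < α) :
    ballInt hα (1 : MvPolynomial (Fin d) 𝕜) ≠ 0 :=
  fun h => one_ne_zero (eq_zero_of_lebesgueInner_self hα h)

lemma sobolevInner_eq_ballInt {α : ℝ} (hα : -1 < α) (p q : MvPolynomial (Fin d) 𝕜) :
    sobolevInner α p q = ballInt hα (gradDot p (conjPoly q)) +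
      (ballInt hα (1 : MvPolynomial (Fin d) 𝕜))⁻¹ *
        (ballInt hα p * starRingEnd 𝕜 (ballInt hα q)) := by
  rw [sobolevInner]
  congr 1
  simp only [gradDot, map_sum, lebesgueInner_eq_ballInt hα, conjPoly, pderiv_map]

lemma sobolevInner_conj_symm {α : ℝ} (hα : -1 < α) (p q : MvPolynomial (Fin d) 𝕜) :
    starRingEnd 𝕜 (sobolevInner α q p) = sobolevInner α p q := by
  simp only [sobolevInner, map_add, map_sum, map_mul, map_inv₀, lebesgueInner_conj_symm hα]
  ring

lemma sobolevInner_self {α : ℝ} (p : MvPolynomial (Fin d) 𝕜) :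
    sobolevInner α p p = ((∑ i, RCLike.re (lebesgueInner α (pderiv i p) (pderiv i p)) +
      (RCLike.re (lebesgueInner α (1 : MvPolynomial (Fin d) 𝕜) 1))⁻¹ *
        ‖lebesgueInner α p 1‖ ^ 2 : ℝ) : 𝕜) := by
  push_cast
  simp only [ofReal_re_lebesgueInner_self]
  rw [sobolevInner, RCLike.mul_conj]

lemma re_sobolevInner_self_nonneg {α : ℝ} (p : MvPolynomial (Fin d) 𝕜) :
    0 ≤ RCLike.re (sobolevInner α p p) := by
  rw [sobolevInner_self, RCLike.ofReal_re]
  exact add_nonneg (Finset.sum_nonneg fun i _ => re_lebesgueInner_self_nonneg _)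
    (mul_nonneg (inv_nonneg.2 (re_lebesgueInner_self_nonneg _)) (sq_nonneg _))

lemma eq_zero_of_sobolevInner_self {α : ℝ} (hα : -1 < α) {p : MvPolynomial (Fin d) 𝕜}
    (h : sobolevInner α p p = 0) : p = 0 := by
  have h1 : RCLike.re (lebesgueInner α (1 : MvPolynomial (Fin d) 𝕜) 1) ≠ 0 := fun h =>
    ballInt_one_ne_zero (𝕜 := 𝕜) (d := d) hα (by
      change lebesgueInner α _ _ = 0
      rw [← ofReal_re_lebesgueInner_self, h, RCLike.ofReal_zero])
  rw [sobolevInner_self, RCLike.ofReal_eq_zero] at h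
  rw [add_eq_zero_iff_of_nonneg
    (Finset.sum_nonneg fun i _ => re_lebesgueInner_self_nonneg _)
    (mul_nonneg (inv_nonneg.2 (re_lebesgueInner_self_nonneg _)) (sq_nonneg _)),
    Finset.sum_eq_zero_iff_of_nonneg fun i _ => re_lebesgueInner_self_nonneg _] at h
  have hp : p = C (coeff 0 p) := eq_C_of_pderiv_eq_zero fun i =>
    eq_zero_of_lebesgueInner_self hα (by
      rw [← ofReal_re_lebesgueInner_self, h.1 i (Finset.mem_univ i), RCLike.ofReal_zero])
  have h2 : ballInt hα p = 0 := by
    change lebesgueInner α p 1 = 0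
    simpa [h1] using h.2
  rw [hp, ← mul_one (C (coeff 0 p)), map_C_mul] at h2
  rw [hp, (mul_eq_zero.1 h2).resolve_right (ballInt_one_ne_zero hα), C_0]

/-- `⟨·,·⟩_{α,1}`, with its arguments exchanged, as an inner product on the space of polynomials. -/
noncomputable abbrev sobolevCore {α : ℝ} (hα : -1 < α) :
    InnerProductSpace.Core 𝕜 (MvPolynomial (Fin d) 𝕜) where
  inner p q := sobolevInner α q p
  conj_inner_symm p q := sobolevInner_conj_symm hα q p
  re_inner_nonneg p := re_sobolevInner_self_nonneg p
  add_left p q r := by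
    rw [← sobolevInner_conj_symm hα, sobolevInner_add hα, map_add, sobolevInner_conj_symm hα,
      sobolevInner_conj_symm hα]
  smul_left p q c := by
    rw [← sobolevInner_conj_symm hα, sobolevInner_smul, map_mul, sobolevInner_conj_symm hα]
  definite p h := eq_zero_of_sobolevInner_self hα h

lemma exists_sobolevInner_sub_eq_zero {α : ℝ} (hα : -1 < α)
    (W : Submodule 𝕜 (MvPolynomial (Fin d) 𝕜)) [FiniteDimensional 𝕜 W]
    (p : MvPolynomial (Fin d) 𝕜) :
    ∃ w ∈ W, ∀ z ∈ W, sobolevInner α (p - w) z = 0 := by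
  let := sobolevCore (𝕜 := 𝕜) (d := d) hα
  let : NormedAddCommGroup (MvPolynomial (Fin d) 𝕜) :=
    InnerProductSpace.Core.toNormedAddCommGroup (𝕜 := 𝕜)
  let : InnerProductSpace 𝕜 (MvPolynomial (Fin d) 𝕜) := InnerProductSpace.ofCore _
  obtain ⟨w, hw, z, hz, h⟩ := W.exists_add_mem_mem_orthogonal p
  refine ⟨w, hw, fun y hy => ?_⟩
  have : p - w = z := by rw [h, add_sub_cancel_left]
  rw [this]
  exact hz y hy

/-- The operator `M^α`, in terms of `u`, `x·∇u` and `Δu`. -/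
theorem opM_eq (α : ℝ) (u : MvPolynomial (Fin d) 𝕜) : opM α u = opMPoly ((α : 𝕜) + 1) u := by
  refine eq_of_polyFun_eq fun x hx => ?_
  have hx0 := one_sub_norm_sq_pos hx
  rw [opM_spec α u hx, opMFun,
    laplacian_eq_iteratedFDeriv_orthonormalBasis _ (EuclideanSpace.basisFun (Fin d) ℝ)]
  simp only [EuclideanSpace.basisFun_apply, iteratedFDeriv_weight_mul _ _ _ hx, Finset.mul_sum]
  have w2 : weight (1 - α) x * weight (1 + α) x = (1 - ‖x‖ ^ 2) ^ 2 := by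
    unfold weight
    rw [← Real.rpow_add hx0, show 1 - α + (1 + α) = ((2 : ℕ) : ℝ) by push_cast; ring,
      Real.rpow_natCast]
  have w1 : weight (1 - α) x * weight (1 + α - 1) x = 1 - ‖x‖ ^ 2 := by
    unfold weight
    rw [← Real.rpow_add hx0]; simp
  have w0 : weight (1 - α) x * weight (1 + α - 2) x = 1 := by
    unfold weight
    rw [← Real.rpow_add hx0, show 1 - α + (1 + α - 2) = 0 by ring, Real.rpow_zero]
  have W2 := congrArg (RCLike.ofReal (K := 𝕜)) w2
  have W1 := congrArg (RCLike.ofReal (K := 𝕜)) w1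
  have W0 := congrArg (RCLike.ofReal (K := 𝕜)) w0
  have hS : ∑ i, ((x i : ℝ) : 𝕜) ^ 2 = ((‖x‖ : ℝ) : 𝕜) ^ 2 := by
    rw [← RCLike.ofReal_pow, EuclideanSpace.norm_sq_eq]
    simp
  have hL : polyFun (lap u) x = ∑ i, polyFun (pderiv i (pderiv i u)) x := by
    rw [lap_apply, polyFun_sum]
  have hE : polyFun (euler u) x = ∑ i, ((x i : ℝ) : 𝕜) * polyFun (pderiv i u) x := by
    rw [euler_apply, polyFun_sum]
    simp [polyFun]
  push_cast at W2 W1 W0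
  set A := ((weight (1 - α) x : ℝ) : 𝕜)
  set B2 := ((weight (1 + α) x : ℝ) : 𝕜)
  set B1 := ((weight (1 + α - 1) x : ℝ) : 𝕜)
  set B0 := ((weight (1 + α - 2) x : ℝ) : 𝕜)
  have hterm (i : Fin d) : A * (B2 * polyFun (pderiv i (pderiv i u)) x +
      B1 * (-4 * ((1 + α : ℝ) : 𝕜) * ((x i : ℝ) : 𝕜) * polyFun (pderiv i u) x -
        2 * ((1 + α : ℝ) : 𝕜) * polyFun u x) +
      B0 * (4 * ((1 + α : ℝ) : 𝕜) * (((1 + α : ℝ) : 𝕜) - 1) * ((x i : ℝ) : 𝕜) ^ 2 *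
        polyFun u x)) =
      A * B2 * polyFun (pderiv i (pderiv i u)) x +
      A * B1 * (-4 * (1 + α)) * (((x i : ℝ) : 𝕜) * polyFun (pderiv i u) x) +
      A * B1 * (-2 * (1 + α) * polyFun u x) +
      A * B0 * (4 * (1 + α) * α * polyFun u x) * ((x i : ℝ) : 𝕜) ^ 2 := by
    push_cast; ring
  rw [Finset.sum_congr rfl fun i _ => hterm i]
  simp only [Finset.sum_add_distrib, ← Finset.mul_sum, hS, ← hL, ← hE, Finset.sum_const,
    Finset.card_univ, Fintype.card_fin, nsmul_eq_mul]
  rw [W2, W1, W0, opMPoly, opN]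
  simp only [polyFun_add, polyFun_sub, polyFun_mul, polyFun_C, polyFun_rho]
  push_cast
  ring

end InnerProducts

/-! ### The orthogonal decomposition -/

section Orthogonality

variable {𝕜 : Type*} [RCLike 𝕜] {d : ℕ}

lemma two_mul_ofReal_add_one_ne_zero {α : ℝ} (hα : -1 < α) : 2 * ((α : 𝕜) + 1) ≠ 0 := by
  have h : 2 * (α + 1) ≠ 0 := by linarith
  exact_mod_cast h

lemma lap_conjPoly (p : MvPolynomial (Fin d) 𝕜) : lap (conjPoly p) = conjPoly (lap p) := by
  simp only [lap_apply, map_sum, conjPoly, pderiv_map]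

lemma euler_conjPoly (p : MvPolynomial (Fin d) 𝕜) : euler (conjPoly p) = conjPoly (euler p) := by
  simp only [euler_apply, map_sum, map_mul, conjPoly, pderiv_map, map_X]

lemma conjPoly_normSqPoly :
    conjPoly (normSqPoly : MvPolynomial (Fin d) 𝕜) = normSqPoly := by
  simp [normSqPoly, conjPoly]

lemma opA_conjPoly (α : ℝ) (p : MvPolynomial (Fin d) 𝕜) :
    opA ((α : 𝕜) + 1) (conjPoly p) = conjPoly (opA ((α : 𝕜) + 1) p) := by
  have h : conjPoly (rho : MvPolynomial (Fin d) 𝕜) = rho := by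
    rw [rho, map_sub, map_one, conjPoly_normSqPoly]
  rw [opA, opA, map_sub, map_mul, map_mul, lap_conjPoly, euler_conjPoly, h]
  simp [conjPoly, map_ofNat (starRingEnd 𝕜) 2]

/-- For a radial weight, a harmonic homogeneous polynomial is orthogonal to all polynomials of lower
degree. Euler's identity and Green's formula trade this for the same statement about its partial
derivatives, with the exponent of the weight raised by one. -/
theorem ballInt_harmonic_mul_eq_zero {α : ℝ} (hα : -1 < α) {m : ℕ} {h q : MvPolynomial (Fin d) 𝕜}
    (hh : h.IsHomogeneous m) (hl : lap h = 0) (hq : q.totalDegree < m) :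
    ballInt hα (h * q) = 0 := by
  induction m generalizing α h q with
  | zero => omega
  | succ m ih =>
    have h1 := map_mul_of_harmonic (ballInt_rho_mul_pderiv hα) hh hl q
    have hα' : -1 < α + 1 := by linarith
    rw [← ballInt_add_one hα hα', gradDot, map_sum, Finset.sum_eq_zero] at h1
    · refine (mul_eq_zero.1 h1).resolve_left
        (mul_ne_zero (two_mul_ofReal_add_one_ne_zero hα) ?_)
      exact_mod_cast Nat.succ_ne_zero m
    · intro i _
      rcases Nat.eq_zero_or_pos q.totalDegree with h0 | h0
      · rw [pderiv_eq_zero_of_totalDegree_eq_zero h0, mul_zero, map_zero]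
      · refine ih hα' (by simpa using hh.pderiv (i := i)) (by rw [lap_pderiv, hl, map_zero]) ?_
        have := totalDegree_pderiv_le i q
        omega

lemma ballInt_harmonic_eq_zero {α : ℝ} (hα : -1 < α) {m : ℕ} (hm : 0 < m)
    {h : MvPolynomial (Fin d) 𝕜} (hh : h.IsHomogeneous m) (hl : lap h = 0) :
    ballInt hα h = 0 := by
  rw [← mul_one h]
  exact ballInt_harmonic_mul_eq_zero hα hh hl (by simpa using hm)

lemma mem_sphericalHarmonics {n : ℕ} {p : MvPolynomial (Fin d) 𝕜} :
    p ∈ sphericalHarmonics 𝕜 d n ↔ p.IsHomogeneous n ∧ lap p = 0 := Iff.rfl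

lemma mem_lebesgueOP {α : ℝ} {hα : -1 < α} {n : ℕ} {p : MvPolynomial (Fin d) 𝕜} :
    p ∈ lebesgueOP 𝕜 d hα n ↔ p.totalDegree ≤ n ∧
      ∀ q : MvPolynomial (Fin d) 𝕜, q.totalDegree < n → lebesgueInner α p q = 0 := by
  refine and_congr (mem_restrictTotalDegree _ _ _) ⟨fun h q hq => ?_, fun h k hk q hq => ?_⟩
  · exact h _ hq q ((mem_restrictTotalDegree _ _ _).2 le_rfl)
  · exact h q (((mem_restrictTotalDegree _ _ _).1 hq).trans_lt hk)

lemma mem_sobolevOP {α : ℝ} {hα : -1 < α} {n : ℕ} {p : MvPolynomial (Fin d) 𝕜} :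
    p ∈ sobolevOP 𝕜 d hα n ↔ p.totalDegree ≤ n ∧
      ∀ q : MvPolynomial (Fin d) 𝕜, q.totalDegree < n → sobolevInner α p q = 0 := by
  refine and_congr (mem_restrictTotalDegree _ _ _) ⟨fun h q hq => ?_, fun h k hk q hq => ?_⟩
  · exact h _ hq q ((mem_restrictTotalDegree _ _ _).2 le_rfl)
  · exact h q (((mem_restrictTotalDegree _ _ _).1 hq).trans_lt hk)

lemma sphericalHarmonics_le_sobolevOP {α : ℝ} (hα : -1 < α) {n : ℕ} (hn : 0 < n) :
    sphericalHarmonics 𝕜 d n ≤ sobolevOP 𝕜 d hα n := by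
  intro h hh
  rw [mem_sphericalHarmonics] at hh
  refine mem_sobolevOP.2 ⟨hh.1.totalDegree_le, fun q hq => ?_⟩
  rw [sobolevInner_eq_ballInt hα, ballInt_harmonic_eq_zero hα hn hh.1 hh.2, gradDot, map_sum,
    Finset.sum_eq_zero]
  · simp
  · intro i _
    have hq' := (totalDegree_conjPoly_le q).trans_lt hq
    rcases Nat.eq_zero_or_pos (conjPoly q).totalDegree with h0 | h0
    · rw [pderiv_eq_zero_of_totalDegree_eq_zero h0, mul_zero, map_zero]
    · refine ballInt_harmonic_mul_eq_zero hα hh.1.pderiv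
        (by rw [lap_pderiv, hh.2, map_zero]) ?_
      have := totalDegree_pderiv_le i (conjPoly q)
      omega

/-- The `(α,1)`-inner product against `M^α u` is, up to a term that only involves mean values, the
inner product of `u` and `-Δ A q` in `L²_{α+1}`. -/
theorem sobolevInner_opM {α : ℝ} (hα : -1 < α) (u q : MvPolynomial (Fin d) 𝕜) :
    sobolevInner α (opM α u) q = -lebesgueInner (α + 1) u (lap (opA ((α : 𝕜) + 1) q)) -
      (ballInt hα (1 : MvPolynomial (Fin d) 𝕜))⁻¹ *
        (2 * d * lebesgueInner (α + 1) u 1 * starRingEnd 𝕜 (ballInt hα q)) := by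
  have hα' : -1 < α + 1 := by linarith
  rw [sobolevInner_eq_ballInt hα, opM_eq,
    map_gradDot_opMPoly (ballInt_rho_mul_pderiv hα) (two_mul_ofReal_add_one_ne_zero hα),
    map_opMPoly (ballInt_rho_mul_pderiv hα), lebesgueInner_eq_ballInt hα',
    lebesgueInner_eq_ballInt hα', ballInt_add_one hα hα', ballInt_add_one hα hα', opA_conjPoly,
    lap_conjPoly, map_one conjPoly, mul_one]
  ring

lemma totalDegree_opM_le (α : ℝ) {u : MvPolynomial (Fin d) 𝕜} {n : ℕ}
    (hu : u.totalDegree ≤ n) : (opM α u).totalDegree ≤ n + 2 := by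
  rw [opM_eq]; exact totalDegree_opMPoly_le _ hu

lemma map_opM_le_sobolevOP {α : ℝ} (hα : -1 < α) (hα' : -1 < α + 1) (k : ℕ) :
    (lebesgueOP 𝕜 d hα' (k + 1)).map (opM α) ≤ sobolevOP 𝕜 d hα (k + 3) := by
  rintro _ ⟨u, hu, rfl⟩
  rw [SetLike.mem_coe, mem_lebesgueOP] at hu
  refine mem_sobolevOP.2 ⟨totalDegree_opM_le α hu.1, fun q hq => ?_⟩
  have h1 := totalDegree_lap_opA_le ((α : 𝕜) + 1) (n := k) (q := q) (by omega)
  rw [sobolevInner_opM hα, hu.2 _ (by omega), hu.2 1 (by simp)]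
  simp

lemma sobolevInner_harmonic_opM {α : ℝ} (hα : -1 < α) (hα' : -1 < α + 1) {n k : ℕ}
    {h u : MvPolynomial (Fin d) 𝕜} (hh : h ∈ sphericalHarmonics 𝕜 d n)
    (hu : u ∈ lebesgueOP 𝕜 d hα' (k + 1)) : sobolevInner α h (opM α u) = 0 := by
  rw [mem_sphericalHarmonics] at hh
  rw [mem_lebesgueOP] at hu
  rw [← sobolevInner_conj_symm hα, sobolevInner_opM hα, hu.2 1 (by simp), lap_opA, hh.2,
    lebesgueInner_eq_ballInt hα']
  simp

lemma sobolevInner_C {α : ℝ} (hα : -1 < α) (p : MvPolynomial (Fin d) 𝕜) (c : 𝕜) :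
    sobolevInner α p (C c) = lebesgueInner α p (C c) := by
  have h1 := ballInt_one_ne_zero (𝕜 := 𝕜) (d := d) hα
  have h2 : starRingEnd 𝕜 (ballInt hα (C c : MvPolynomial (Fin d) 𝕜)) =
      ballInt hα (1 : MvPolynomial (Fin d) 𝕜) * starRingEnd 𝕜 c := by
    rw [conj_ballInt, conjPoly, map_C, ← mul_one (C _), map_C_mul, mul_comm]
  rw [sobolevInner_eq_ballInt hα, h2, lebesgueInner_eq_ballInt hα, conjPoly, map_C, gradDot_comm,
    gradDot_C_left, map_zero, mul_comm p, map_C_mul]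
  field_simp
  ring

lemma ballInt_eq_zero_of_mem_sobolevOP {α : ℝ} (hα : -1 < α) {n : ℕ} (hn : 0 < n)
    {p : MvPolynomial (Fin d) 𝕜} (hp : p ∈ sobolevOP 𝕜 d hα n) : ballInt hα p = 0 := by
  have h := (mem_sobolevOP.1 hp).2 (C 1) (by simpa using hn)
  rw [sobolevInner_C hα, C_1] at h
  exact h

/-- An element of `V^{α,1}_n` is determined by its homogeneous component of degree `n`. -/
lemma eq_of_mem_sobolevOP {α : ℝ} (hα : -1 < α) {n : ℕ} {p q : MvPolynomial (Fin d) 𝕜}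
    (hp : p ∈ sobolevOP 𝕜 d hα n) (hq : q ∈ sobolevOP 𝕜 d hα n)
    (h : (p - q).totalDegree < n) : p = q :=
  sub_eq_zero.1 <| eq_zero_of_sobolevInner_self hα <| (mem_sobolevOP.1 (sub_mem hp hq)).2 _ h

lemma totalDegree_sub_homogeneousComponent_lt {n : ℕ} (hn : 0 < n) {p : MvPolynomial (Fin d) 𝕜}
    (hp : p.totalDegree ≤ n) : (p - homogeneousComponent n p).totalDegree < n := by
  classical
  refine (Finset.sup_lt_iff hn).2 fun m hm => ?_
  rw [mem_support_iff, coeff_sub, coeff_homogeneousComponent] at hm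
  change m.degree < n
  split_ifs at hm with h
  · simp at hm
  · rw [sub_zero] at hm
    have : m.degree ≤ n := (le_totalDegree (mem_support_iff.2 hm)).trans hp
    omega

/-- An element of `V^{α,1}_n`, `n ≥ 3`, that is killed by `Δ ∘ A` is harmonic: its Laplacian is
constant, and orthogonality to `‖x‖²` excludes nonzero constants. -/
lemma lap_eq_zero_of_mem_sobolevOP (hd : 1 ≤ d) {α : ℝ} (hα : -1 < α) {n : ℕ} (hn : 3 ≤ n)
    {p : MvPolynomial (Fin d) 𝕜} (hp : p ∈ sobolevOP 𝕜 d hα n)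
    (h : lap (opA ((α : 𝕜) + 1) p) = 0) : lap p = 0 := by
  have hα' : -1 < α + 1 := by linarith
  have hc := lap_eq_C_of_lap_opA_eq_zero hd hα h
  -- with `‖x‖²`, the Dirichlet form is `2 ∫ E p (1 - ‖x‖²)^α`, a multiple of the mean of `Δp`
  have h1 := (mem_sobolevOP.1 hp).2 normSqPoly (totalDegree_normSqPoly_le.trans_lt (by omega))
  rw [sobolevInner_eq_ballInt hα, ballInt_eq_zero_of_mem_sobolevOP hα (by omega) hp,
    conjPoly_normSqPoly] at h1
  have h2 : gradDot p normSqPoly = C 2 * euler p := by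
    rw [gradDot, euler_apply, Finset.mul_sum]
    refine Finset.sum_congr rfl fun i _ => ?_
    rw [pderiv_normSqPoly, map_ofNat]; ring
  rw [h2, map_C_mul, zero_mul, mul_zero, add_zero] at h1
  have h3 := map_rho_mul_gradDot (ballInt_rho_mul_pderiv hα) 1 p
  rw [← C_1, gradDot_C_left, mul_zero, map_zero, C_1, one_mul, one_mul,
    (mul_eq_zero.1 h1).resolve_left two_ne_zero, hc, ← ballInt_add_one hα hα',
    ← mul_one (C _), map_C_mul] at h3
  have h4 := ballInt_one_ne_zero (𝕜 := 𝕜) (d := d) hα'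
  have h5 : coeff 0 (lap p) = 0 := by simpa [h4] using h3
  rw [hc, h5, C_0]

/-- The elements of `V^{α,1}_n` that are orthogonal to the image of `M^α` are harmonic and
homogeneous. -/
theorem mem_sphericalHarmonics_of_orthogonal (hd : 1 ≤ d) {α : ℝ} (hα : -1 < α)
    (hα' : -1 < α + 1) {k : ℕ} {p : MvPolynomial (Fin d) 𝕜}
    (hp : p ∈ sobolevOP 𝕜 d hα (k + 3))
    (ho : ∀ z ∈ (lebesgueOP 𝕜 d hα' (k + 1)).map (opM α), sobolevInner α p z = 0) :
    p ∈ sphericalHarmonics 𝕜 d (k + 3) := by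
  have hI := ballInt_eq_zero_of_mem_sobolevOP hα (by omega) hp
  set s := lap (opA ((α : 𝕜) + 1) p) with hs
  have hadj (u : MvPolynomial (Fin d) 𝕜) :
      lebesgueInner (α + 1) s u = -sobolevInner α p (opM α u) := by
    rw [← lebesgueInner_conj_symm hα', ← sobolevInner_conj_symm hα, sobolevInner_opM hα, ← hs, hI]
    simp
  have hsV : s ∈ lebesgueOP 𝕜 d hα' (k + 1) := by
    refine mem_lebesgueOP.2 ⟨totalDegree_lap_opA_le _ (mem_sobolevOP.1 hp).1, fun u hu => ?_⟩
    have := totalDegree_opM_le α (n := k) (u := u) (by omega)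
    rw [hadj, (mem_sobolevOP.1 hp).2 _ (by omega), neg_zero]
  have hs0 : s = 0 := eq_zero_of_lebesgueInner_self hα' (by
    rw [hadj, ho _ ⟨s, hsV, rfl⟩, neg_zero])
  have hl := lap_eq_zero_of_mem_sobolevOP hd hα (by omega) hp hs0
  have hH : homogeneousComponent (k + 3) p ∈ sphericalHarmonics 𝕜 d (k + 3) :=
    mem_sphericalHarmonics.2
      ⟨homogeneousComponent_isHomogeneous _ _, lap_homogeneousComponent _ hl⟩
  rw [eq_of_mem_sobolevOP hα hp (sphericalHarmonics_le_sobolevOP hα (by omega) hH)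
    (totalDegree_sub_homogeneousComponent_lt (by omega) (mem_sobolevOP.1 hp).1)]
  exact hH

/-- The decomposition for degrees at least three: split off the `⟨·,·⟩_{α,1}`-orthogonal projection
to the image of `M^α`; what remains is harmonic and homogeneous. -/
theorem isOrthogonalDirectSum_sobolevOP (hd : 1 ≤ d) {α : ℝ} (hα : -1 < α) (hα' : -1 < α + 1)
    (k : ℕ) :
    IsOrthogonalDirectSum α (sobolevOP 𝕜 d hα (k + 3)) (sphericalHarmonics 𝕜 d (k + 3))
      ((lebesgueOP 𝕜 d hα' (k + 1)).map (opM α)) := by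
  have ho : ∀ a ∈ sphericalHarmonics 𝕜 d (k + 3),
      ∀ b ∈ (lebesgueOP 𝕜 d hα' (k + 1)).map (opM α), sobolevInner α a b = 0 := by
    rintro a ha _ ⟨u, hu, rfl⟩
    exact sobolevInner_harmonic_opM hα hα' ha hu
  refine ⟨le_antisymm ?_ (sup_le (sphericalHarmonics_le_sobolevOP hα (by omega))
    (map_opM_le_sobolevOP hα hα' k)), ?_, ho⟩
  · intro p hp
    have : FiniteDimensional 𝕜 (lebesgueOP 𝕜 d hα' (k + 1)) :=
      Submodule.finiteDimensional_of_le
        (show lebesgueOP 𝕜 d hα' (k + 1) ≤ restrictTotalDegree (Fin d) 𝕜 (k + 1) from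
          fun _ h => h.1)
    obtain ⟨w, hw, hpw⟩ :=
      exists_sobolevInner_sub_eq_zero hα ((lebesgueOP 𝕜 d hα' (k + 1)).map (opM α)) p
    rw [← sub_add_cancel p w]
    exact Submodule.add_mem_sup (mem_sphericalHarmonics_of_orthogonal hd hα hα'
      (sub_mem hp (map_opM_le_sobolevOP hα hα' k hw)) hpw) hw
  · exact Submodule.disjoint_def.2 fun x hx hx' =>
      eq_zero_of_sobolevInner_self hα (ho x hx x hx')

/-! ### Degrees at most two -/

lemma isHomogeneous_sub_C_of_totalDegree_le_one {p : MvPolynomial (Fin d) 𝕜}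
    (hp : p.totalDegree ≤ 1) : (p - C (coeff 0 p)).IsHomogeneous 1 := by
  intro m hm
  rw [coeff_sub, coeff_C] at hm
  change Finsupp.weight (fun _ => 1) m = 1
  rw [← Finsupp.degree_eq_weight_one]
  split_ifs at hm with h
  · simp [← h] at hm
  · rw [sub_zero] at hm
    have h1 : m.degree ≤ 1 := (le_totalDegree (mem_support_iff.2 hm)).trans hp
    have h2 : m.degree ≠ 0 := fun h0 => h ((Finsupp.degree_eq_zero_iff m).1 h0).symm
    change m.degree = 1
    omega

lemma ballInt_of_totalDegree_le_one {α : ℝ} (hα : -1 < α) {p : MvPolynomial (Fin d) 𝕜}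
    (hp : p.totalDegree ≤ 1) :
    ballInt hα p = coeff 0 p * ballInt hα (1 : MvPolynomial (Fin d) 𝕜) := by
  have hh := isHomogeneous_sub_C_of_totalDegree_le_one hp
  have h := ballInt_harmonic_eq_zero hα one_pos hh
    (lap_eq_zero_of_totalDegree_lt_two (hh.totalDegree_le.trans_lt one_lt_two))
  rw [map_sub, ← mul_one (C _), map_C_mul] at h
  exact sub_eq_zero.1 h

/-- On polynomials of degree at most two, the two inner products with a linear form are
proportional. -/
lemma lebesgueInner_linear {α : ℝ} (hα : -1 < α) (hα' : -1 < α + 1)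
    {p q : MvPolynomial (Fin d) 𝕜} (hp : p.totalDegree ≤ 2) (hq : q.IsHomogeneous 1) :
    2 * ((α : 𝕜) + 1) * ballInt hα (1 : MvPolynomial (Fin d) 𝕜) * lebesgueInner α p q =
      ballInt hα' (1 : MvPolynomial (Fin d) 𝕜) * sobolevInner α p q := by
  have hq' : (conjPoly q).IsHomogeneous 1 := hq.map _
  have hl (r : MvPolynomial (Fin d) 𝕜) (hr : r.IsHomogeneous 1) : lap r = 0 :=
    lap_eq_zero_of_totalDegree_lt_two (hr.totalDegree_le.trans_lt one_lt_two)
  have h1 := map_mul_of_harmonic (ballInt_rho_mul_pderiv hα) hq' (hl _ hq') p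
  have hg : (gradDot (conjPoly q) p).totalDegree ≤ 1 := by
    refine totalDegree_finsetSum_le fun i _ => (totalDegree_mul _ _).trans ?_
    have h2 := totalDegree_pderiv_le i (conjPoly q)
    have h3 := totalDegree_pderiv_le i p
    have h4 := hq'.totalDegree_le
    omega
  rw [← ballInt_add_one hα hα', ballInt_of_totalDegree_le_one hα' hg, Nat.cast_one, mul_one] at h1
  rw [sobolevInner_eq_ballInt hα, ballInt_harmonic_eq_zero hα one_pos hq (hl q hq), gradDot_comm,
    ballInt_of_totalDegree_le_one hα hg, lebesgueInner_eq_ballInt hα, mul_comm p, map_zero]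
  linear_combination ballInt hα (1 : MvPolynomial (Fin d) 𝕜) * h1

lemma lebesgueInner_linear_eq_zero_iff {α : ℝ} (hα : -1 < α) {p q : MvPolynomial (Fin d) 𝕜}
    (hp : p.totalDegree ≤ 2) (hq : q.IsHomogeneous 1) :
    lebesgueInner α p q = 0 ↔ sobolevInner α p q = 0 := by
  have hα' : -1 < α + 1 := by linarith
  have h := lebesgueInner_linear hα hα' hp hq
  have h1 := mul_ne_zero (two_mul_ofReal_add_one_ne_zero (𝕜 := 𝕜) hα)
    (ballInt_one_ne_zero (𝕜 := 𝕜) (d := d) hα)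
  have h2 := ballInt_one_ne_zero (𝕜 := 𝕜) (d := d) hα'
  refine ⟨fun h0 => ?_, fun h0 => ?_⟩
  · rw [h0, mul_zero] at h
    exact (mul_eq_zero.1 h.symm).resolve_left h2
  · rw [h0, mul_zero] at h
    exact (mul_eq_zero.1 h).resolve_left h1

lemma sobolevInner_add_right {α : ℝ} (hα : -1 < α) (p q r : MvPolynomial (Fin d) 𝕜) :
    sobolevInner α p (q + r) = sobolevInner α p q + sobolevInner α p r := by
  rw [← sobolevInner_conj_symm hα, sobolevInner_add hα, map_add, sobolevInner_conj_symm hα,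
    sobolevInner_conj_symm hα]

lemma lebesgueInner_add_right {α : ℝ} (hα : -1 < α) (p q r : MvPolynomial (Fin d) 𝕜) :
    lebesgueInner α p (q + r) = lebesgueInner α p q + lebesgueInner α p r := by
  rw [← lebesgueInner_conj_symm hα, lebesgueInner_add hα, map_add, lebesgueInner_conj_symm hα,
    lebesgueInner_conj_symm hα]

theorem sobolevOP_eq_lebesgueOP {α : ℝ} (hα : -1 < α) {n : ℕ} (hn : n ≤ 2) :
    sobolevOP 𝕜 d hα n = lebesgueOP 𝕜 d hα n := by
  ext p
  rw [mem_sobolevOP, mem_lebesgueOP]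
  refine and_congr_right fun hp => ?_
  have hsplit (q : MvPolynomial (Fin d) 𝕜) : q = C (coeff 0 q) + (q - C (coeff 0 q)) := by ring
  have hdeg {q : MvPolynomial (Fin d) 𝕜} (hq : q.totalDegree < n) :
      (C (coeff 0 q) : MvPolynomial (Fin d) 𝕜).totalDegree < n ∧
        (q - C (coeff 0 q)).totalDegree < n := by
    have h0 : (C (coeff 0 q) : MvPolynomial (Fin d) 𝕜).totalDegree < n := by
      rw [totalDegree_C]; omega
    exact ⟨h0, (totalDegree_sub _ _).trans_lt (max_lt hq h0)⟩
  have hlin {q : MvPolynomial (Fin d) 𝕜} (hq : q.totalDegree < n) :=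
    isHomogeneous_sub_C_of_totalDegree_le_one (p := q) (by omega)
  refine ⟨fun h q hq => ?_, fun h q hq => ?_⟩
  · rw [hsplit q, lebesgueInner_add_right hα, ← sobolevInner_C hα, h _ (hdeg hq).1,
      (lebesgueInner_linear_eq_zero_iff hα (hp.trans hn) (hlin hq)).2 (h _ (hdeg hq).2), add_zero]
  · rw [hsplit q, sobolevInner_add_right hα, sobolevInner_C hα, h _ (hdeg hq).1,
      (lebesgueInner_linear_eq_zero_iff hα (hp.trans hn) (hlin hq)).1 (h _ (hdeg hq).2), add_zero]

end Orthogonality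

theorem mainTheorem4 {𝕜 : Type*} [RCLike 𝕜] (d : ℕ) (hd : 1 ≤ d) (α : ℝ) (hα : -1 < α) (n : ℕ) :
    (n ≤ 2 → sobolevOP 𝕜 d hα n = lebesgueOP 𝕜 d hα n) ∧
    (3 ≤ n →
      IsOrthogonalDirectSum α (sobolevOP 𝕜 d hα n) (sphericalHarmonics 𝕜 d n)
        ((lebesgueOP 𝕜 d (α := α + 1) (by linarith) (n - 2)).map (opM α))) := by
  refine ⟨fun hn => sobolevOP_eq_lebesgueOP hα hn, fun hn => ?_⟩
  obtain ⟨k, rfl⟩ := Nat.exists_eq_add_of_le' hn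
  exact isOrthogonalDirectSum_sobolevOP hd hα (by linarith) k
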